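/- Let $m\ge 1$ and $n\ge 1$ be integers (for $n=1$ the hyperplane below is a point carrying unit mass). Put $\mathbb{R}^n_0=\{\boldsymbol\xi\in\mathbb{R}^n\mid \xi_1+\cdots+\xi_n=0\}$ with its $(n-1)$-dimensional Euclidean Lebesgue measure $d\boldsymbol\xi$, $\mathbb{A}=\{\boldsymbol\xi\in\mathbb{R}^n_0\mid \xi_1>\xi_2>\cdots>\xi_n>\xi_1-2\pi\}$ (the $SU(n)$ alcove), and $\rho(\boldsymbol\xi)=\prod_{1\le j<k\le n}|e^{i\xi_j}-e^{i\xi_k}|^2$. Let $\varrho=(\varrho_1,\ldots,\varrho_n)$ with $\varrho_j=\frac12(n+1-2j)$, let $\omega_j=e_1+\cdots+e_j-\frac jn(e_1+\cdots+e_n)$ for $1\le j\le n-1$, and for $D\in\mathbb{Z}_{\ge0}$ let $$\Lambda^{(D)}=\{l_1\omega_1+\cdots+l_{n-1}\omega_{n-1}\mid l_j\in\mathbb{Z}_{\ge 0},\ l_1+\cdots+l_{n-1}\le D\}.$$ Let $\mathbb{P}^{(D)}$ be the complex span of the symmetric monomials $M_\mu$, $\mu\in\Lambda^{(D)}$, where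 $$M_\mu(\boldsymbol\xi)=\frac1{N_\mu}\sum_{\sigma\in S_n}\exp(i\xi_{\sigma_1}\mu_1+\cdots+i\xi_{\sigma_n}\mu_n),\qquad N_\mu=\prod_{1\le j<k\le n,\ \mu_j=\mu_k}\frac{1+k-j}{k-j}.$$ For $-1<q<1$ let $$C(\boldsymbol\xi;q)=\prod_{1\le j<k\le n}\frac{1-qe^{-i(\xi_j-\xi_k)}}{1-e^{-i(\xi_j-\xi_k)}},\qquad P_\mu(\boldsymbol\xi;q)=\sum_{\sigma\in S_n}C(\xi_{\sigma_1},\ldots,\xi_{\sigma_n};q)\,e^{i\xi_{\sigma_1}\mu_1+\cdots+i\xi_{\sigma_n}\mu_n}$$ (the Hall-Littlewood polynomials), let $$\delta_\mu(q)=\prod_{\substack{1\le j<k\le n\\ \mu_j-\mu_k=0}}\frac{1-q^{k-j}}{1-q^{1+k-j}}\prod_{\substack{1\le j<k\le n\\ \mu_j-\mu_k=m}}\frac{1-q^{n-k+j}}{1-q^{n+1-k+j}},$$ and for $\lambda\in\Lambda^{(m)}$ let $\boldsymbol\xi_\lambda(q)$ (the node with label $\lambda$) be the unique global minimum over $\mathbb{R}^n$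 of $$V_\lambda(\boldsymbol\xi)=\sum_{1\le j<k\le n}\int_0^{\xi_j-\xi_k}v_q(\vartheta)\,d\vartheta+\sum_{j=1}^n\Bigl(\frac m2\xi_j^2-2\pi(\varrho_j+\lambda_j)\xi_j\Bigr),\qquad v_q(\vartheta)=\int_0^\vartheta\frac{1-q^2}{1-2q\cos\theta+q^2}\,d\theta .$$ Let the weight of the node be $$\Delta_\lambda(q)=|C(\boldsymbol\xi_\lambda(q);q)|^2\Bigl(\sum_{\mu\in\Lambda^{(m)}}|P_\mu(\boldsymbol\xi_\lambda(q);q)|^2\delta_\mu(q)\Bigr)^{-1}.$$ Then, at $q=0$: (i) for every $\lambda\in\Lambda^{(m)}$, $V_\lambda$ has the unique global minimum $\boldsymbol\xi_\lambda(0)=\frac{2\pi(\varrho+\lambda)}{m+n}$, and this point belongs to $\mathbb{A}$; (ii) $|C(\boldsymbol\xi;0)|^{-2}=\rho(\boldsymbol\xi)$ on $\mathbb{A}$, and $\Delta_\lambda(0)=\frac1{n(n+m)^{n-1}}$ for every $\lambda\in\Lambda^{(m)}$; (iii) for every $f\in\mathbb{P}^{(2m+1)}$ the function $f\rho$ is integrable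 on $\mathbb{A}$ and $$\frac1{(2\pi)^{n-1}n^{1/2}}\int_{\mathbb{A}}f(\boldsymbol\xi)\rho(\boldsymbol\xi)\,d\boldsymbol\xi=\frac1{n(n+m)^{n-1}}\sum_{\lambda\in\Lambda^{(m)}}f\Bigl(\frac{2\pi(\varrho+\lambda)}{m+n}\Bigr)\rho\Bigl(\frac{2\pi(\varrho+\lambda)}{m+n}\Bigr);$$ (iv) the degree $2m+1$ is the optimal Gaussian one: the number of nodes in (iii) is $\binom{m+n-1}{m}=\dim\mathbb{P}^{(m)}$; every cubature rule $\frac1{(2\pi)^{n-1}n^{1/2}}\int_{\mathbb{A}}f\rho\,d\boldsymbol\xi=\sum_{i=1}^Nw_if(\boldsymbol x_i)$ with $\boldsymbol x_i\in\mathbb{R}^n_0$ and $w_i\in\mathbb{C}$ that is exact for all $f\in\mathbb{P}^{(2m+1)}$ has $N\ge\binom{m+n-1}{m}$ nodes; and if $n\ge2$, no such rule with $N=\binom{m+n-1}{m}$ is exact for all $f\in\mathbb{P}^{(2m+2)}$. -/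

import Mathlib

open MeasureTheory

noncomputable section

namespace SchurCubature

/-! Vectors of `ℝⁿ` are functions `Fin n → ℝ`; the index `j : Fin n` stands for `j + 1`. -/

/-! ### Integration on the hyperplane of vectors with coordinate sum zero -/

/-- The hyperplane `ξ₁ + ⋯ + ξₙ = 0` of the Euclidean space `ℝⁿ`. -/
def hyperplane (n : ℕ) : Submodule ℝ (EuclideanSpace ℝ (Fin n)) where
  carrier := {ξ | ∑ j, ξ j = 0}
  add_mem' := by
    intro a b ha hb
    simp only [Set.mem_ofPred_eq] at ha hb ⊢
    simp [Finset.sum_add_distrib, ha, hb]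
  zero_mem' := by simp
  smul_mem' := by
    intro c a ha
    simp only [Set.mem_ofPred_eq] at ha ⊢
    simp [← Finset.mul_sum, ha]

/-- The inclusion of the hyperplane in `ℝⁿ`. -/
def hyperplaneIncl (n : ℕ) (ξ : hyperplane n) : Fin n → ℝ :=
  fun j => (ξ : EuclideanSpace ℝ (Fin n)) j

theorem measurable_hyperplaneIncl (n : ℕ) : Measurable (hyperplaneIncl n) := by
  unfold hyperplaneIncl
  fun_prop

/-- The Lebesgue measure `dξ` of the `(n-1)`-dimensional Euclidean space `hyperplane n` (unit
cubes of an orthonormal basis have measure one), regarded as a measure on `ℝⁿ` that is carried by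
the hyperplane. The instance is named because the default measure on a subtype is the restricted
measure of the ambient space, under which a hyperplane is a null set. -/
def hyperplaneVolume (n : ℕ) : Measure (Fin n → ℝ) :=
  Measure.map (hyperplaneIncl n)
    (@volume (hyperplane n) (measureSpaceOfInnerProductSpace (E := hyperplane n)))

/-- The open alcove `ξ₁ > ξ₂ > ⋯ > ξₙ > ξ₁ - 2π` in the hyperplane `ξ₁ + ⋯ + ξₙ = 0`. -/
def alcove (n : ℕ) : Set (Fin n → ℝ) :=
  {ξ | ∑ j, ξ j = 0 ∧ (∀ j k, j < k → ξ k < ξ j) ∧ ∀ j k, ξ j - 2 * Real.pi < ξ k}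

/-- The density `∏_{j<k} |e^{iξⱼ} - e^{iξₖ}|²` of the circular unitary ensemble. -/
def cueDensity {n : ℕ} (ξ : Fin n → ℝ) : ℝ :=
  ∏ j, ∏ k ∈ Finset.Ioi j,
    ‖Complex.exp (Complex.I * ξ j) - Complex.exp (Complex.I * ξ k)‖ ^ 2

/-- `(2π)^{-(n-1)} n^{-1/2} ∫_{alcove} f(ξ) ρ(ξ) dξ` with `ρ` the density `cueDensity`. -/
def cueIntegral (n : ℕ) (f : (Fin n → ℝ) → ℂ) : ℂ :=
  ((1 / ((2 * Real.pi) ^ (n - 1) * Real.sqrt n) : ℝ) : ℂ) *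
    ∫ ξ in alcove n, f ξ * (cueDensity ξ : ℂ) ∂(hyperplaneVolume n)

/-! ### Weights and symmetric polynomials -/

/-- The fundamental weight `e₁ + ⋯ + eⱼ - (j/n)(e₁ + ⋯ + eₙ)`, `1 ≤ j ≤ n - 1`. -/
def fundamentalWeight (n : ℕ) (j : Fin (n - 1)) : Fin n → ℝ :=
  fun i => (if (i : ℕ) ≤ (j : ℕ) then 1 else 0) - ((j : ℕ) + 1 : ℝ) / n

/-- The weights `l₁ω₁ + ⋯ + l_{n-1}ω_{n-1}` with `l₁, …, l_{n-1} ∈ ℕ` and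
`l₁ + ⋯ + l_{n-1} ≤ m`. -/
def dominantWeights (m n : ℕ) : Set (Fin n → ℝ) :=
  {μ | ∃ l : Fin (n - 1) → ℕ, ∑ j, l j ≤ m ∧ μ = ∑ j, (l j : ℝ) • fundamentalWeight n j}

theorem dominantWeights_finite (m n : ℕ) : (dominantWeights m n).Finite := by
  have h : (Set.Iic (fun _ : Fin (n - 1) => m)).Finite := Set.finite_Iic _
  refine (h.image fun l : Fin (n - 1) → ℕ =>
    ∑ j, (l j : ℝ) • fundamentalWeight n j).subset ?_
  rintro μ ⟨l, hl, rfl⟩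
  refine ⟨l, fun j => ?_, rfl⟩
  exact (Finset.single_le_sum (fun i _ => Nat.zero_le (l i)) (Finset.mem_univ j)).trans hl

/-- `dominantWeights m n` as a `Finset`. -/
def dominantWeightsFinset (m n : ℕ) : Finset (Fin n → ℝ) :=
  (dominantWeights_finite m n).toFinset

/-- `exp(i ξ_{σ₁} μ₁ + ⋯ + i ξ_{σₙ} μₙ)`. -/
def permExp {n : ℕ} (μ ξ : Fin n → ℝ) (σ : Equiv.Perm (Fin n)) : ℂ :=
  Complex.exp (Complex.I * ∑ k, ((ξ (σ k) * μ k : ℝ) : ℂ))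

/-- `∏_{j<k, μⱼ=μₖ} (1+k-j)/(k-j)`, the order of the stabilizer of a dominant weight `μ` in the
symmetric group. -/
def stabilizerOrder {n : ℕ} (μ : Fin n → ℝ) : ℝ :=
  ∏ j, ∏ k ∈ Finset.Ioi j with μ j - μ k = 0,
    (1 + ((k : ℕ) : ℝ) - ((j : ℕ) : ℝ)) / (((k : ℕ) : ℝ) - ((j : ℕ) : ℝ))

/-- The symmetric monomial `M_μ`. -/
def symmMonomial {n : ℕ} (μ : Fin n → ℝ) : (Fin n → ℝ) → ℂ :=
  fun ξ => (1 / (stabilizerOrder μ : ℂ)) * ∑ σ : Equiv.Perm (Fin n), permExp μ ξ σ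

/-- The space of symmetric polynomials spanned over `ℂ` by the `M_μ` with `μ` of level at
most `D`. -/
def symmPoly (D n : ℕ) : Submodule ℂ ((Fin n → ℝ) → ℂ) :=
  Submodule.span ℂ (symmMonomial '' dominantWeights D n)

/-! ### Hall-Littlewood polynomials, spectral nodes and Christoffel weights -/

/-- `∏_{j<k} (1 - q e^{-i(ξⱼ-ξₖ)}) / (1 - e^{-i(ξⱼ-ξₖ)})`. -/
def cFun {n : ℕ} (q : ℝ) (ξ : Fin n → ℝ) : ℂ :=
  ∏ j, ∏ k ∈ Finset.Ioi j,
    (1 - q * Complex.exp (-Complex.I * (ξ j - ξ k))) /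
      (1 - Complex.exp (-Complex.I * (ξ j - ξ k)))

/-- The Hall-Littlewood polynomial `P_μ(ξ; q)`, at points `ξ` where the denominators do not
vanish. -/
def hallLittlewood {n : ℕ} (q : ℝ) (μ ξ : Fin n → ℝ) : ℂ :=
  ∑ σ : Equiv.Perm (Fin n), cFun q (fun k => ξ (σ k)) * permExp μ ξ σ

/-- The discrete orthogonality weight `δ_μ(q)` of level `m`. -/
def discreteWeight {n : ℕ} (m : ℕ) (q : ℝ) (μ : Fin n → ℝ) : ℝ :=
  (∏ j : Fin n, ∏ k ∈ Finset.Ioi j with μ j - μ k = 0,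
      (1 - q ^ ((k : ℕ) - (j : ℕ))) / (1 - q ^ (1 + (k : ℕ) - (j : ℕ)))) *
    ∏ j : Fin n, ∏ k ∈ Finset.Ioi j with μ j - μ k = m,
      (1 - q ^ (n - (k : ℕ) + (j : ℕ))) / (1 - q ^ (n + 1 - (k : ℕ) + (j : ℕ)))

/-- The vector `ρ` with components `(n + 1 - 2j)/2`, `1 ≤ j ≤ n`. -/
def weylVector (n : ℕ) : Fin n → ℝ :=
  fun j => ((n : ℝ) + 1 - 2 * ((j : ℕ) + 1)) / 2

/-- `u_q(θ) = (1 - q²) / (1 - 2 q cos θ + q²)`. -/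
def uFun (q θ : ℝ) : ℝ := (1 - q ^ 2) / (1 - 2 * q * Real.cos θ + q ^ 2)

/-- `v_q(ϑ) = ∫₀^ϑ u_q(θ) dθ`. -/
def vFun (q ϑ : ℝ) : ℝ := ∫ θ in (0 : ℝ)..ϑ, uFun q θ

/-- The Morse function `V_λ` on `ℝⁿ`, at level `m`. -/
def morse {n : ℕ} (m : ℕ) (q : ℝ) (lam ξ : Fin n → ℝ) : ℝ :=
  (∑ j, ∑ k ∈ Finset.Ioi j, ∫ ϑ in (0 : ℝ)..(ξ j - ξ k), vFun q ϑ) +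
    ∑ j, ((m : ℝ) / 2 * ξ j ^ 2 - 2 * Real.pi * (weylVector n j + lam j) * ξ j)

/-- `ξ` is the spectral node with label `lam` at level `m`: the unique global minimum of `V_λ`. -/
def IsSpectralNode {n : ℕ} (m : ℕ) (q : ℝ) (lam ξ : Fin n → ℝ) : Prop :=
  ∀ η : Fin n → ℝ, η ≠ ξ → morse m q lam ξ < morse m q lam η

/-- The Christoffel weight `(∑_μ |P_μ(ξ; q)|² δ_μ(q))⁻¹` at a node `ξ`, for the rule that
integrates against `|C(ξ; q)|⁻²`. -/
def christoffelHat {n : ℕ} (m : ℕ) (q : ℝ) (ξ : Fin n → ℝ) : ℝ :=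
  (∑ μ ∈ dominantWeightsFinset m n, ‖hallLittlewood q μ ξ‖ ^ 2 * discreteWeight m q μ)⁻¹

/-- The Christoffel weight `|C(ξ; q)|² (∑_μ |P_μ(ξ; q)|² δ_μ(q))⁻¹` at a node `ξ`. -/
def christoffel {n : ℕ} (m : ℕ) (q : ℝ) (ξ : Fin n → ℝ) : ℝ :=
  ‖cFun q ξ‖ ^ 2 * christoffelHat m q ξ

/-- The point `2π(ρ + λ)/(m + n)`. -/
def schurNode {n : ℕ} (m : ℕ) (lam : Fin n → ℝ) : Fin n → ℝ :=
  fun j => 2 * Real.pi * (weylVector n j + lam j) / ((m : ℝ) + n)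

/-- The nodes `x₁, …, x_N` in the hyperplane `ξ₁ + ⋯ + ξₙ = 0` and the complex weights
`w₁, …, w_N` form a cubature rule for the density `cueDensity` on the alcove that is exact on all
symmetric polynomials of degree at most `D`. -/
def IsExactCubature (n D N : ℕ) (x : Fin N → Fin n → ℝ) (w : Fin N → ℂ) : Prop :=
  (∀ i, ∑ j, x i j = 0) ∧ ∀ f ∈ symmPoly D n, cueIntegral n f = ∑ i, w i * f (x i)

end SchurCubature

end

noncomputable section

namespace SchurCubature

open scoped Nat Pointwise

/-! ### Elements of the weight lattice -/

/-! At `q = 0` everything is expressed by the alternating sums A_κ(ξ) = ∑ sign(σ) exp(i⟨κ, ξ_σ⟩),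
written `altSum κ`. By the Vandermonde determinant the density is A_ϱ times its conjugate A_{-ϱ},
and the Hall-Littlewood polynomial becomes the Weyl quotient A_{ϱ+μ}/A_ϱ. The Morse function is
quadratic, so its minimum is found by completing squares.

The engine is a discrete orthogonality relation (`sum_schurNode_altSum_mul_altSum`). With N = m+n,
the sum of A_κ A_ν over the nodes is n N^(n-1) times a signed count of the permutations π with κ∘π =
-ν, provided the coordinate spreads of κ and ν add up to less than 2N. Up to translation the nodes
are the grid points of mesh 2π/N in an open simplex. Antisymmetry turns the sum over them into a sum
over a full cube, where characters are summed factor by factor. If the characters do not descend to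
the cube, a cyclic rotation of the simplex shows that the sum vanishes.

Exactness: f·|A_ϱ|² expands into products A_{ϱ+μ∘π} A_{-ϱ}, with total spread at most 2(n-1) +
(2m+1) < 2N in degree 2m+1. The signed count does not depend on N, so the normalized node sum is
constant in N once N is large. It is also a Riemann sum, so the constant is the integral, which
never has to be computed separately.

Weights: A_κ(cν) = A_ν(cκ) exchanges weights and nodes, so the Christoffel sum is again an
orthogonality sum.

Optimality: a triangularity argument (`sum_orbitSum_unisolvent`) shows that the nodes are unisolvent
for degree m, which also gives the dimension. If f of degree m vanishes at the nodes of a rule exact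
in degree 2m, then |f|² has integral zero. Positivity of the rule at the Schur nodes then forces f =
0, so evaluation is injective and bounds the number of nodes below. Degree 2m+2 is excluded by the
same bound for m+1. -/

/-- `κ` lies in the weight lattice (coordinate sum zero, integral coordinate differences), and the
differences of its coordinates are at most `D`. -/
def WeightLE {n : ℕ} (D : ℤ) (κ : Fin n → ℝ) : Prop :=
  ∑ j, κ j = 0 ∧ ∀ j k, ∃ z : ℤ, κ j - κ k = z ∧ z ≤ D

namespace WeightLE

variable {n : ℕ} {D E : ℤ} {κ ν : Fin n → ℝ}

theorem add (h : WeightLE D κ) (h' : WeightLE E ν) : WeightLE (D + E) (κ + ν) := by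
  refine ⟨by simp [Finset.sum_add_distrib, h.1, h'.1], fun j k => ?_⟩
  obtain ⟨z, hz, hzD⟩ := h.2 j k
  obtain ⟨w, hw, hwE⟩ := h'.2 j k
  refine ⟨z + w, ?_, by omega⟩
  push_cast
  simp only [Pi.add_apply]
  linarith

theorem neg (h : WeightLE D κ) : WeightLE D (-κ) := by
  refine ⟨by simp [h.1], fun j k => ?_⟩
  obtain ⟨z, hz, hzD⟩ := h.2 k j
  exact ⟨z, by simp only [Pi.neg_apply]; linarith, hzD⟩

theorem comp_perm (h : WeightLE D κ) (σ : Equiv.Perm (Fin n)) : WeightLE D (κ ∘ σ) :=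
  ⟨by simpa using (Equiv.sum_comp σ κ).trans h.1, fun j k => h.2 _ _⟩

theorem mono (h : WeightLE D κ) (hDE : D ≤ E) : WeightLE E κ :=
  ⟨h.1, fun j k => (h.2 j k).imp fun _ hz => ⟨hz.1, hz.2.trans hDE⟩⟩

theorem sub_le (h : WeightLE D κ) (j k : Fin n) : κ j - κ k ≤ D := by
  obtain ⟨z, hz, hzD⟩ := h.2 j k
  rw [hz]
  exact_mod_cast hzD

end WeightLE

theorem sum_weylVector (n : ℕ) : ∑ j, weylVector n j = 0 := by
  have h : ∑ j : Fin n, weylVector n j = ∑ j : Fin n, weylVector n (Fin.rev j) :=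
    (Equiv.sum_comp Fin.revPerm (weylVector n)).symm
  have h2 : ∑ j : Fin n, (weylVector n j + weylVector n (Fin.rev j)) = 0 := by
    refine Finset.sum_eq_zero fun j _ => ?_
    simp only [weylVector, Fin.val_rev]
    rw [Nat.cast_sub (by omega)]
    push_cast
    ring
  rw [Finset.sum_add_distrib, ← h] at h2
  linarith

theorem weylVector_sub (n : ℕ) (j k : Fin n) :
    weylVector n j - weylVector n k = ((k : ℕ) : ℝ) - ((j : ℕ) : ℝ) := by
  simp only [weylVector]
  ring

theorem weightLE_weylVector (n : ℕ) : WeightLE ((n : ℤ) - 1) (weylVector n) := by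
  refine ⟨sum_weylVector n, fun j k => ⟨((k : ℕ) : ℤ) - ((j : ℕ) : ℤ), ?_, ?_⟩⟩
  · rw [weylVector_sub]
    push_cast
    ring
  · omega

theorem sum_fundamentalWeight (p : ℕ) (j : Fin p) :
    ∑ i, fundamentalWeight (p + 1) j i = 0 := by
  simp only [fundamentalWeight, Finset.sum_sub_distrib, Finset.sum_const, Finset.card_univ,
    Fintype.card_fin, nsmul_eq_mul]
  have h : ∑ i : Fin (p + 1), (if (i : ℕ) ≤ (j : ℕ) then (1 : ℝ) else 0) = (j : ℕ) + 1 := by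
    rw [Finset.sum_boole]
    have : (Finset.univ.filter fun i : Fin (p + 1) => (i : ℕ) ≤ (j : ℕ)) =
        Finset.Iic j.castSucc := by
      ext i
      simp [Fin.le_def]
    rw [this, Fin.card_Iic]
    simp
  rw [h]
  field_simp
  simp

theorem fundamentalWeight_sub (p : ℕ) (j i : Fin p) :
    fundamentalWeight (p + 1) j i.castSucc - fundamentalWeight (p + 1) j i.succ =
      if i = j then 1 else 0 := by
  simp only [fundamentalWeight, Fin.val_castSucc, Fin.val_succ, Fin.ext_iff]
  split_ifs <;> first | omega | simp

theorem eq_of_sum_eq_of_sub_eq {p : ℕ} {x y : Fin (p + 1) → ℝ} (hs : ∑ j, x j = ∑ j, y j)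
    (h : ∀ j : Fin p, x j.castSucc - x j.succ = y j.castSucc - y j.succ) : x = y := by
  have key : ∀ j : Fin (p + 1), x j - y j = x 0 - y 0 := by
    intro j
    induction j using Fin.induction with
    | zero => rfl
    | succ i ih => linarith [h i]
  have h0 : ∑ j, (x j - y j) = 0 := by rw [Finset.sum_sub_distrib, hs, sub_self]
  rw [Finset.sum_congr rfl fun j _ => key j] at h0
  simp only [Finset.sum_const, Finset.card_univ, Fintype.card_fin, nsmul_eq_mul] at h0
  have h1 : x 0 - y 0 = 0 := by
    rcases mul_eq_zero.mp h0 with h | h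
    · exact absurd h (by positivity)
    · exact h
  funext j
  linarith [key j]

theorem sum_sub_succ {p : ℕ} (x : Fin (p + 1) → ℝ) :
    ∑ j : Fin p, (x j.castSucc - x j.succ) = x 0 - x (Fin.last p) := by
  rw [Finset.sum_sub_distrib]
  have h1 := Fin.sum_univ_castSucc x
  have h2 := Fin.sum_univ_succ x
  linarith

theorem dominantWeights_sub {p : ℕ} (l : Fin p → ℕ) (i : Fin p) :
    (∑ j, (l j : ℝ) • fundamentalWeight (p + 1) j) i.castSucc -
      (∑ j, (l j : ℝ) • fundamentalWeight (p + 1) j) i.succ = l i := by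
  simp only [Finset.sum_apply, Pi.smul_apply, smul_eq_mul, ← Finset.sum_sub_distrib, ← mul_sub]
  rw [Finset.sum_congr rfl fun j _ => by rw [fundamentalWeight_sub]]
  simp

/-- The level ∑ l_j telescopes to the difference of the first and last coordinates, so for a
dominant weight it is the spread of the coordinates. In this form the bound is stable under
permutations and negation and additive under sums. -/
theorem mem_dominantWeights_iff {p D : ℕ} {μ : Fin (p + 1) → ℝ} :
    μ ∈ dominantWeights D (p + 1) ↔ WeightLE D μ ∧ Antitone μ := by
  constructor
  · rintro ⟨l, hl, hμ⟩
    change Fin p → ℕ at l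
    have hd : ∀ i : Fin p, μ i.castSucc - μ i.succ = l i := by
      intro i
      rw [hμ]
      exact dominantWeights_sub l i
    have hs : ∑ j, μ j = 0 := by
      rw [hμ]
      simp only [Finset.sum_apply, Pi.smul_apply, smul_eq_mul]
      rw [Finset.sum_comm]
      refine Finset.sum_eq_zero fun j _ => ?_
      rw [← Finset.mul_sum, sum_fundamentalWeight p j, mul_zero]
    have ha : Antitone μ := by
      rw [Fin.antitone_iff_succ_le]
      intro i
      have := hd i
      have : (0 : ℝ) ≤ l i := Nat.cast_nonneg _
      linarith
    refine ⟨⟨hs, ?_⟩, ha⟩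
    have hz : ∀ j, ∃ z : ℤ, μ j = μ 0 - z := by
      intro j
      induction j using Fin.induction with
      | zero => exact ⟨0, by simp⟩
      | succ i ih =>
        obtain ⟨z, hz⟩ := ih
        exact ⟨z + l i, by push_cast; linarith [hd i]⟩
    intro j k
    obtain ⟨a, ha'⟩ := hz j
    obtain ⟨b, hb⟩ := hz k
    refine ⟨b - a, by push_cast; linarith, ?_⟩
    have h1 : μ 0 - μ (Fin.last p) = ∑ j, (l j : ℝ) := by
      rw [← sum_sub_succ]
      exact Finset.sum_congr rfl fun i _ => hd i
    have h2 : (∑ j, (l j : ℝ)) ≤ D := by exact_mod_cast hl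
    have h3 : μ j ≤ μ 0 := ha (Fin.zero_le j)
    have h4 : μ (Fin.last p) ≤ μ k := ha (Fin.le_last k)
    have h5 : ((b - a : ℤ) : ℝ) ≤ ((D : ℤ) : ℝ) := by push_cast; linarith
    exact_mod_cast h5
  · rintro ⟨⟨hs, hd⟩, ha⟩
    have h : ∀ i : Fin p, ∃ l : ℕ, μ i.castSucc - μ i.succ = l := by
      intro i
      obtain ⟨z, hz, -⟩ := hd i.castSucc i.succ
      have h0 : (0 : ℝ) ≤ z := by
        rw [← hz, sub_nonneg]
        exact ha (Fin.castSucc_le_succ i)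
      obtain ⟨l, rfl⟩ := Int.eq_ofNat_of_zero_le (by exact_mod_cast h0 : (0 : ℤ) ≤ z)
      exact ⟨l, by simpa using hz⟩
    choose l hl using h
    refine ⟨l, ?_, ?_⟩
    · obtain ⟨z, hz, hzD⟩ := hd 0 (Fin.last p)
      rw [← sum_sub_succ, Finset.sum_congr rfl fun i _ => hl i] at hz
      have : ((∑ j, l j : ℕ) : ℤ) = z := by exact_mod_cast hz
      have h' : ((∑ j, l j : ℕ) : ℤ) ≤ D := by omega
      exact_mod_cast h'
    · refine eq_of_sum_eq_of_sub_eq ?_ fun i => ?_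
      · rw [hs]
        simp only [Finset.sum_apply, Pi.smul_apply, smul_eq_mul]
        rw [Finset.sum_comm]
        refine (Finset.sum_eq_zero fun j _ => ?_).symm
        rw [← Finset.mul_sum, sum_fundamentalWeight p j, mul_zero]
      · rw [hl i]
        exact (dominantWeights_sub l i).symm

theorem mem_dominantWeightsFinset_iff {p D : ℕ} {μ : Fin (p + 1) → ℝ} :
    μ ∈ dominantWeightsFinset D (p + 1) ↔ WeightLE D μ ∧ Antitone μ := by
  rw [dominantWeightsFinset, Set.Finite.mem_toFinset, mem_dominantWeights_iff]

/-! ### Symmetric and alternating exponential sums -/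

section ExpSums

variable {n : ℕ}

theorem permExp_comp_left (κ ξ : Fin n → ℝ) (π σ : Equiv.Perm (Fin n)) :
    permExp (κ ∘ π) ξ (σ * π) = permExp κ ξ σ := by
  simp only [permExp, Function.comp_apply, Equiv.Perm.mul_apply]
  congr 2
  exact Equiv.sum_comp π fun k => ((ξ (σ k) * κ k : ℝ) : ℂ)

theorem permExp_comp_right (κ ξ : Fin n → ℝ) (π σ : Equiv.Perm (Fin n)) :
    permExp κ (ξ ∘ π) σ = permExp κ ξ (π * σ) := rfl

theorem permExp_mul (κ ν ξ : Fin n → ℝ) (σ : Equiv.Perm (Fin n)) :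
    permExp κ ξ σ * permExp ν ξ σ = permExp (κ + ν) ξ σ := by
  simp only [permExp]
  rw [← Complex.exp_add, ← mul_add, ← Finset.sum_add_distrib]
  congr 2
  refine Finset.sum_congr rfl fun k _ => ?_
  push_cast [Pi.add_apply]
  ring

theorem conj_permExp (κ ξ : Fin n → ℝ) (σ : Equiv.Perm (Fin n)) :
    (starRingEnd ℂ) (permExp κ ξ σ) = permExp (-κ) ξ σ := by
  simp only [permExp]
  rw [← Complex.exp_conj, map_mul, map_sum, Complex.conj_I]
  congr 1
  rw [neg_mul, ← mul_neg, ← Finset.sum_neg_distrib]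
  congr 1
  refine Finset.sum_congr rfl fun k _ => ?_
  rw [Complex.conj_ofReal]
  push_cast [Pi.neg_apply]
  ring

theorem permExp_add_const {κ : Fin n → ℝ} (hκ : ∑ j, κ j = 0) (ξ : Fin n → ℝ) (c : ℝ)
    (σ : Equiv.Perm (Fin n)) : permExp κ (fun j => ξ j + c) σ = permExp κ ξ σ := by
  simp only [permExp, ← Complex.ofReal_sum]
  congr 3
  simp only [add_mul, Finset.sum_add_distrib, ← Finset.mul_sum, hκ, mul_zero, add_zero]

/-- The sum of the exponentials `permExp κ ξ σ` over all permutations. -/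
def orbitSum (κ : Fin n → ℝ) : (Fin n → ℝ) → ℂ :=
  fun ξ => ∑ σ : Equiv.Perm (Fin n), permExp κ ξ σ

/-- The alternating sum of the exponentials `permExp κ ξ σ` over all permutations. -/
def altSum (κ : Fin n → ℝ) : (Fin n → ℝ) → ℂ :=
  fun ξ => ∑ σ : Equiv.Perm (Fin n), (Equiv.Perm.sign σ : ℂ) * permExp κ ξ σ

theorem orbitSum_comp_left (κ ξ : Fin n → ℝ) (π : Equiv.Perm (Fin n)) :
    orbitSum (κ ∘ π) ξ = orbitSum κ ξ := by
  simp only [orbitSum]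
  rw [← Equiv.sum_comp (Equiv.mulRight π)]
  exact Finset.sum_congr rfl fun σ _ => permExp_comp_left κ ξ π σ

theorem sign_mul_self (π : Equiv.Perm (Fin n)) :
    ((Equiv.Perm.sign π : ℤ) : ℂ) * ((Equiv.Perm.sign π : ℤ) : ℂ) = 1 := by
  rcases Int.units_eq_one_or (Equiv.Perm.sign π) with h | h <;> simp [h]

theorem conj_sign (π : Equiv.Perm (Fin n)) :
    (starRingEnd ℂ) ((Equiv.Perm.sign π : ℤ) : ℂ) = ((Equiv.Perm.sign π : ℤ) : ℂ) := by
  simp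

theorem altSum_comp_right (κ ξ : Fin n → ℝ) (π : Equiv.Perm (Fin n)) :
    altSum κ (ξ ∘ π) = (Equiv.Perm.sign π : ℂ) * altSum κ ξ := by
  simp only [altSum]
  rw [← Equiv.sum_comp (Equiv.mulLeft π) fun σ => (Equiv.Perm.sign σ : ℂ) * permExp κ ξ σ,
    Finset.mul_sum]
  refine Finset.sum_congr rfl fun σ _ => ?_
  rw [Equiv.coe_mulLeft, permExp_comp_right, Equiv.Perm.sign_mul]
  push_cast
  linear_combination (-(Equiv.Perm.sign σ : ℂ) * permExp κ ξ (π * σ)) * sign_mul_self π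

theorem altSum_eq_zero (κ : Fin n → ℝ) {ξ : Fin n → ℝ} {i j : Fin n} (hij : i ≠ j)
    (h : ξ i = ξ j) : altSum κ ξ = 0 := by
  have h1 := altSum_comp_right κ ξ (Equiv.swap i j)
  have h2 : ξ ∘ Equiv.swap i j = ξ := by
    funext k
    rcases eq_or_ne k i with rfl | hi
    · simp [h]
    · rcases eq_or_ne k j with rfl | hj
      · simp [h]
      · simp [Equiv.swap_apply_of_ne_of_ne hi hj]
  rw [h2, Equiv.Perm.sign_swap hij] at h1
  push_cast at h1
  linear_combination h1 / 2

theorem conj_orbitSum (κ ξ : Fin n → ℝ) :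
    (starRingEnd ℂ) (orbitSum κ ξ) = orbitSum (-κ) ξ := by
  simp only [orbitSum, map_sum, conj_permExp]

theorem conj_altSum (κ ξ : Fin n → ℝ) :
    (starRingEnd ℂ) (altSum κ ξ) = altSum (-κ) ξ := by
  simp only [altSum, map_sum, map_mul, conj_permExp, conj_sign]

theorem altSum_add_const {κ : Fin n → ℝ} (hκ : ∑ j, κ j = 0) (ξ : Fin n → ℝ) (c : ℝ) :
    altSum κ (fun j => ξ j + c) = altSum κ ξ := by
  simp only [altSum, permExp_add_const hκ]

theorem orbitSum_add_const {κ : Fin n → ℝ} (hκ : ∑ j, κ j = 0) (ξ : Fin n → ℝ) (c : ℝ) :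
    orbitSum κ (fun j => ξ j + c) = orbitSum κ ξ := by
  simp only [orbitSum, permExp_add_const hκ]

theorem sum_permExp_comp (ν ξ : Fin n → ℝ) (σ : Equiv.Perm (Fin n)) :
    ∑ π : Equiv.Perm (Fin n), permExp (ν ∘ π) ξ σ = orbitSum ν ξ := by
  have h : ∀ π : Equiv.Perm (Fin n), permExp (ν ∘ π) ξ σ = permExp ν ξ (σ * π⁻¹) := by
    intro π
    rw [← permExp_comp_left ν ξ π, inv_mul_cancel_right]
  rw [Finset.sum_congr rfl fun π _ => h π]
  exact Equiv.sum_comp ((Equiv.inv (Equiv.Perm (Fin n))).trans (Equiv.mulLeft σ))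
    fun τ => permExp ν ξ τ

theorem orbitSum_mul_orbitSum (κ ν ξ : Fin n → ℝ) :
    orbitSum κ ξ * orbitSum ν ξ = ∑ π : Equiv.Perm (Fin n), orbitSum (κ + ν ∘ π) ξ := by
  simp only [orbitSum, ← permExp_mul]
  rw [Finset.sum_comm, Finset.sum_mul]
  refine Finset.sum_congr rfl fun σ _ => ?_
  rw [← Finset.mul_sum, sum_permExp_comp, orbitSum]

/-- For fixed σ, the symmetric factor may be rewritten as the sum over π of the exponentials of μ∘π
at that same σ, so the product can be formed termwise. Applied to κ = ϱ this absorbs a polynomial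
into one half of the density. -/
theorem orbitSum_mul_altSum (μ κ ξ : Fin n → ℝ) :
    orbitSum μ ξ * altSum κ ξ = ∑ π : Equiv.Perm (Fin n), altSum (κ + μ ∘ π) ξ := by
  simp only [altSum, ← permExp_mul]
  rw [Finset.sum_comm, Finset.mul_sum]
  refine Finset.sum_congr rfl fun σ _ => ?_
  rw [← Finset.mul_sum, ← Finset.mul_sum, sum_permExp_comp]
  ring

theorem permExp_continuous (κ : Fin n → ℝ) (σ : Equiv.Perm (Fin n)) :
    Continuous fun ξ => permExp κ ξ σ := by
  unfold permExp
  fun_prop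

theorem orbitSum_continuous (κ : Fin n → ℝ) : Continuous (orbitSum κ) :=
  continuous_finsetSum _ fun σ _ => permExp_continuous κ σ

theorem altSum_continuous (κ : Fin n → ℝ) : Continuous (altSum κ) :=
  continuous_finsetSum _ fun σ _ => continuous_const.mul (permExp_continuous κ σ)

theorem stabilizerOrder_pos (μ : Fin n → ℝ) : 0 < stabilizerOrder μ := by
  refine Finset.prod_pos fun j _ => Finset.prod_pos fun k hk => ?_
  have hjk : j < k := by simpa using (Finset.mem_filter.mp hk).1
  have : ((j : ℕ) : ℝ) < ((k : ℕ) : ℝ) := by exact_mod_cast hjk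
  exact div_pos (by linarith) (by linarith)

theorem symmMonomial_eq (μ : Fin n → ℝ) :
    symmMonomial μ = (1 / (stabilizerOrder μ : ℂ)) • orbitSum μ := rfl

theorem orbitSum_eq_smul (μ : Fin n → ℝ) :
    orbitSum μ = (stabilizerOrder μ : ℂ) • symmMonomial μ := by
  have h : (stabilizerOrder μ : ℂ) ≠ 0 := by exact_mod_cast (stabilizerOrder_pos μ).ne'
  rw [symmMonomial_eq, smul_smul, mul_one_div_cancel h, one_smul]

end ExpSums

theorem exists_perm_antitone {n : ℕ} (κ : Fin n → ℝ) :
    ∃ σ : Equiv.Perm (Fin n), Antitone (κ ∘ σ) :=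
  ⟨Tuple.sort (fun j => -κ j), fun i j hij => by
    simpa using Tuple.monotone_sort (fun j => -κ j) hij⟩

theorem orbitSum_mem_symmPoly {p D : ℕ} {κ : Fin (p + 1) → ℝ} (hκ : WeightLE D κ) :
    orbitSum κ ∈ symmPoly D (p + 1) := by
  obtain ⟨σ, hσ⟩ := exists_perm_antitone κ
  have h : orbitSum κ = orbitSum (κ ∘ σ) := by
    funext ξ
    rw [orbitSum_comp_left]
  rw [h, orbitSum_eq_smul]
  exact Submodule.smul_mem _ _ (Submodule.subset_span
    ⟨_, mem_dominantWeights_iff.mpr ⟨hκ.comp_perm σ, hσ⟩, rfl⟩)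

/-- Dropping dominance of the generators makes closure under products and conjugation immediate,
since κ + ν∘π and -κ need not be dominant. -/
theorem symmPoly_eq_span (D p : ℕ) :
    symmPoly D (p + 1) = Submodule.span ℂ (orbitSum '' {κ : Fin (p + 1) → ℝ | WeightLE D κ}) := by
  apply le_antisymm
  · refine Submodule.span_le.mpr ?_
    rintro _ ⟨μ, hμ, rfl⟩
    rw [symmMonomial_eq]
    exact Submodule.smul_mem _ _ (Submodule.subset_span
      ⟨μ, (mem_dominantWeights_iff.mp hμ).1, rfl⟩)
  · refine Submodule.span_le.mpr ?_
    rintro _ ⟨κ, hκ, rfl⟩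
    exact orbitSum_mem_symmPoly hκ

theorem mul_mem_symmPoly {p D E : ℕ} {f g : (Fin (p + 1) → ℝ) → ℂ}
    (hf : f ∈ symmPoly D (p + 1)) (hg : g ∈ symmPoly E (p + 1)) :
    f * g ∈ symmPoly (D + E) (p + 1) := by
  rw [symmPoly_eq_span] at hf hg
  have h := Submodule.mul_mem_mul hf hg
  rw [Submodule.span_mul_span] at h
  refine Submodule.span_le.mpr ?_ h
  rintro _ ⟨_, ⟨κ, hκ, rfl⟩, _, ⟨ν, hν, rfl⟩, rfl⟩
  have : orbitSum κ * orbitSum ν = ∑ π : Equiv.Perm (Fin (p + 1)), orbitSum (κ + ν ∘ π) := by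
    funext ξ
    simpa using orbitSum_mul_orbitSum κ ν ξ
  change orbitSum κ * orbitSum ν ∈ _
  rw [this]
  refine Submodule.sum_mem _ fun π _ => orbitSum_mem_symmPoly ?_
  push_cast
  exact WeightLE.add hκ (WeightLE.comp_perm hν π)

theorem conj_mem_symmPoly {p D : ℕ} {f : (Fin (p + 1) → ℝ) → ℂ}
    (hf : f ∈ symmPoly D (p + 1)) :
    (fun ξ => (starRingEnd ℂ) (f ξ)) ∈ symmPoly D (p + 1) := by
  rw [symmPoly_eq_span] at hf
  induction hf using Submodule.span_induction with
  | mem x h =>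
    obtain ⟨κ, hκ, rfl⟩ := h
    simp only [conj_orbitSum]
    exact orbitSum_mem_symmPoly hκ.neg
  | zero =>
    simp only [Pi.zero_apply, map_zero]
    exact Submodule.zero_mem _
  | add x y _ _ hx hy =>
    simp only [Pi.add_apply, map_add]
    exact Submodule.add_mem _ hx hy
  | smul a x _ hx =>
    simp only [Pi.smul_apply, smul_eq_mul, map_mul]
    exact Submodule.smul_mem _ ((starRingEnd ℂ) a) hx

theorem symmPoly_mono {p D E : ℕ} (h : D ≤ E) : symmPoly D (p + 1) ≤ symmPoly E (p + 1) := by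
  rw [symmPoly_eq_span, symmPoly_eq_span]
  exact Submodule.span_mono (Set.image_mono fun κ hκ => WeightLE.mono hκ (by exact_mod_cast h))

/-! ### Discrete orthogonality of the alternating sums -/

/-- An injective tuple is a strictly increasing tuple composed with exactly one permutation, and the
other tuples contribute nothing. -/
theorem sum_piFinset_eq_factorial_mul {α R : Type*} [LinearOrder α] [CommSemiring R] {p : ℕ}
    (s : Finset α) (H : (Fin p → α) → R) (hsymm : ∀ d (σ : Equiv.Perm (Fin p)), H (d ∘ σ) = H d)
    (hinj : ∀ d, ¬ Function.Injective d → H d = 0) :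
    ∑ d ∈ Fintype.piFinset fun _ => s, H d =
      (p ! : R) * ∑ d ∈ (Fintype.piFinset fun _ : Fin p => s) with StrictMono d, H d := by
  classical
  have h1 : ∑ d ∈ (Fintype.piFinset fun _ : Fin p => s) with Function.Injective d, H d =
      ∑ d ∈ Fintype.piFinset fun _ => s, H d :=
    Finset.sum_filter_of_ne fun d _ hd => by
      by_contra h
      exact hd (hinj d h)
  have h2 : ∑ x ∈ (Finset.univ : Finset (Equiv.Perm (Fin p))) ×ˢ
        (Fintype.piFinset fun _ : Fin p => s).filter StrictMono, H x.2 =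
      (p ! : R) * ∑ d ∈ (Fintype.piFinset fun _ : Fin p => s) with StrictMono d, H d := by
    rw [Finset.sum_product]
    simp [Fintype.card_perm]
  rw [← h1, ← h2]
  symm
  refine Finset.sum_bij (fun x _ => x.2 ∘ x.1) ?_ ?_ ?_ ?_
  · rintro ⟨σ, d⟩ hx
    simp only [Finset.mem_product, Finset.mem_filter, Fintype.mem_piFinset, Finset.mem_univ,
      true_and] at hx ⊢
    exact ⟨fun j => hx.1 _, hx.2.injective.comp σ.injective⟩
  · rintro ⟨σ, d⟩ hx ⟨τ, e⟩ hy hxy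
    simp only [Finset.mem_product, Finset.mem_filter, Fintype.mem_piFinset, Finset.mem_univ,
      true_and] at hx hy hxy
    have hr : Set.range d = Set.range e := by
      have := congrArg Set.range hxy
      rwa [EquivLike.range_comp, EquivLike.range_comp] at this
    have hde : d = e := (StrictMono.range_inj hx.2 hy.2).mp hr
    subst hde
    have : σ = τ := Equiv.ext fun j => hx.2.injective (congrFun hxy j)
    rw [this]
  · intro d hd
    simp only [Finset.mem_filter, Fintype.mem_piFinset] at hd
    refine ⟨((Tuple.sort d)⁻¹, d ∘ Tuple.sort d), ?_, ?_⟩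
    · simp only [Finset.mem_product, Finset.mem_filter, Fintype.mem_piFinset, Finset.mem_univ,
        true_and]
      exact ⟨fun j => hd.1 _, (Tuple.monotone_sort d).strictMono_of_injective
        (hd.2.comp (Tuple.sort d).injective)⟩
    · funext j
      simp
  · rintro ⟨σ, d⟩ _
    exact (hsymm d σ).symm

/-- The strictly increasing sequences of length `p` of integers strictly between `0` and `N`. -/
def chains (p N : ℕ) : Finset (Fin p → ℕ) :=
  (Fintype.piFinset fun _ => Finset.Ioo 0 N).filter StrictMono

theorem mem_chains {p N : ℕ} {d : Fin p → ℕ} :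
    d ∈ chains p N ↔ (∀ j, 0 < d j ∧ d j < N) ∧ StrictMono d := by
  simp [chains, Fintype.mem_piFinset]

/-- The preceding symmetrization is applied to the indicator of injectivity, whose sum over the cube
counts embeddings. -/
theorem card_chains (p N : ℕ) : (chains p N).card = (N - 1).choose p := by
  have h := sum_piFinset_eq_factorial_mul (R := ℕ) (p := p) (Finset.Ioo 0 N)
    (fun d => if Function.Injective d then 1 else 0)
    (fun d σ => by simp) (fun d hd => by simp [hd])
  have h1 : ∑ d ∈ (Fintype.piFinset fun _ : Fin p => Finset.Ioo 0 N) with StrictMono d,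
      (if Function.Injective d then 1 else 0) = (chains p N).card := by
    rw [chains, Finset.card_eq_sum_ones]
    refine Finset.sum_congr rfl fun d hd => ?_
    rw [if_pos (Finset.mem_filter.mp hd).2.injective]
  have h2 : ∑ d ∈ Fintype.piFinset fun _ : Fin p => Finset.Ioo 0 N,
      (if Function.Injective d then 1 else 0) = (N - 1).descFactorial p := by
    rw [Finset.sum_boole, Nat.cast_id]
    have : Fintype.card (Fin p ↪ Finset.Ioo 0 N) = (N - 1).descFactorial p := by
      rw [Fintype.card_embedding_eq]
      simp
    rw [← this, ← Finset.card_univ]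
    symm
    refine Finset.card_bij (fun f _ j => (f j : ℕ)) ?_ ?_ ?_
    · intro f _
      simp only [Finset.mem_filter, Fintype.mem_piFinset]
      exact ⟨fun j => (f j).2, fun i j hij => f.injective (Subtype.ext hij)⟩
    · intro f _ g _ hfg
      ext j
      exact congrFun hfg j
    · intro d hd
      simp only [Finset.mem_filter, Fintype.mem_piFinset] at hd
      exact ⟨⟨fun j => ⟨d j, hd.1 j⟩, fun i j hij => hd.2 (congrArg Subtype.val hij)⟩,
        Finset.mem_univ _, rfl⟩
  rw [h1, h2, Nat.descFactorial_eq_factorial_mul_choose, Nat.cast_id] at h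
  exact (Nat.eq_of_mul_eq_mul_left (Nat.factorial_pos p) h).symm

/-! ### Character sums on the grid of mesh 2π/N. -/

/-- The vector `-2π (0, x₁, …, x_p)`. -/
def simplexPoint {p : ℕ} (x : Fin p → ℝ) : Fin (p + 1) → ℝ :=
  fun j => -(2 * Real.pi) * (Fin.cons 0 x : Fin (p + 1) → ℝ) j

/-- The point of the grid of mesh `2π/N` with label `d`. -/
def gridPoint {p : ℕ} (N : ℕ) (d : Fin p → ℕ) : Fin (p + 1) → ℝ :=
  simplexPoint fun i => (d i : ℝ) / N

theorem simplexPoint_zero {p : ℕ} (x : Fin p → ℝ) : simplexPoint x 0 = 0 := by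
  simp [simplexPoint]

theorem simplexPoint_succ {p : ℕ} (x : Fin p → ℝ) (i : Fin p) :
    simplexPoint x i.succ = -(2 * Real.pi) * x i := by
  simp [simplexPoint]

theorem simplexPoint_comp {p : ℕ} (x : Fin p → ℝ) (σ : Equiv.Perm (Fin p)) :
    simplexPoint (x ∘ σ) = simplexPoint x ∘ Equiv.Perm.decomposeFin.symm (0, σ) := by
  funext j
  refine Fin.cases ?_ (fun i => ?_) j
  · simp [simplexPoint_zero]
  · simp [simplexPoint_succ]

theorem sum_range_exp (N : ℕ) (hN : 0 < N) (z : ℤ) :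
    ∑ c ∈ Finset.range N, Complex.exp (Complex.I * ((-(2 * Real.pi) * ((c : ℝ) / N) * z : ℝ) : ℂ)) =
      if (N : ℤ) ∣ z then (N : ℂ) else 0 := by
  have hN0 : (N : ℂ) ≠ 0 := by exact_mod_cast hN.ne'
  set ζ : ℂ := Complex.exp (-(2 * Real.pi * Complex.I) * z / N) with hζ
  have h1 : ∀ c : ℕ, Complex.exp (Complex.I * ((-(2 * Real.pi) * ((c : ℝ) / N) * z : ℝ) : ℂ)) =
      ζ ^ c := by
    intro c
    rw [hζ, ← Complex.exp_nat_mul]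
    congr 1
    push_cast
    ring
  simp only [h1]
  split_ifs with h
  · obtain ⟨w, rfl⟩ := h
    have : ζ = 1 := by
      rw [hζ, Complex.exp_eq_one_iff]
      refine ⟨-w, ?_⟩
      push_cast
      field_simp
    simp [this]
  · have hne : ζ ≠ 1 := by
      intro h'
      rw [hζ, Complex.exp_eq_one_iff] at h'
      obtain ⟨w, hw⟩ := h'
      apply h
      refine ⟨-w, ?_⟩
      have hpi : (2 * Real.pi * Complex.I : ℂ) ≠ 0 := Complex.two_pi_I_ne_zero
      have h3 : (2 * Real.pi * Complex.I : ℂ) * (z + N * w) = 0 := by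
        field_simp at hw
        linear_combination (-2 * Complex.I * Real.pi) * hw
      have h4 : (z + N * w : ℂ) = 0 := (mul_eq_zero.mp h3).resolve_left hpi
      have h5 : z + N * w = 0 := by exact_mod_cast h4
      linarith
    have hpow : ζ ^ N = 1 := by
      rw [hζ, ← Complex.exp_nat_mul, Complex.exp_eq_one_iff]
      refine ⟨-z, ?_⟩
      push_cast
      field_simp
    have := mul_geom_sum ζ N
    rw [hpow, sub_self] at this
    exact (mul_eq_zero.mp this).resolve_left (sub_ne_zero.mpr hne)

/-- The sum factors into geometric sums, so it survives only if w lies in N times the integer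
lattice. The coordinate sum zero together with a spread below 2N then leaves w = 0 alone. This
strict bound is what ultimately limits the degree to 2m+1. -/
theorem sum_exp_gridPoint {p N : ℕ} (hN : 0 < N) {w : Fin (p + 1) → ℝ} (hs : ∑ j, w j = 0)
    (hw : ∀ j, ∃ z : ℤ, w j = z) (hlt : ∀ j k, w j - w k < 2 * N) :
    ∑ d ∈ Fintype.piFinset fun _ : Fin p => Finset.range N,
      Complex.exp (Complex.I * ∑ j, ((gridPoint N d j * w j : ℝ) : ℂ)) =
      if w = 0 then (N : ℂ) ^ p else 0 := by
  choose z hz using hw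
  have h1 : ∀ d : Fin p → ℕ,
      Complex.exp (Complex.I * ∑ j, ((gridPoint N d j * w j : ℝ) : ℂ)) =
      ∏ i : Fin p, Complex.exp
        (Complex.I * ((-(2 * Real.pi) * ((d i : ℝ) / N) * z i.succ : ℝ) : ℂ)) := by
    intro d
    rw [← Complex.exp_sum, Fin.sum_univ_succ, ← Finset.mul_sum]
    congr 2
    simp only [gridPoint, simplexPoint_zero, simplexPoint_succ, hz]
    simp
  simp only [h1]
  rw [← Finset.prod_univ_sum (fun _ : Fin p => Finset.range N) fun i c => Complex.exp
    (Complex.I * ((-(2 * Real.pi) * ((c : ℝ) / N) * z i.succ : ℝ) : ℂ))]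
  simp only [sum_range_exp N hN]
  split_ifs with h
  · have : ∀ i : Fin p, z i.succ = 0 := by
      intro i
      have := congrFun h i.succ
      rw [hz, Pi.zero_apply] at this
      exact_mod_cast this
    simp [this]
  · by_contra hne
    rw [← ne_eq, Finset.prod_ne_zero_iff] at hne
    have hdvd : ∀ i : Fin p, (N : ℤ) ∣ z i.succ := by
      intro i
      by_contra h'
      exact hne i (Finset.mem_univ _) (if_neg h')
    have hsz : ∑ j, z j = 0 := by
      have : ((∑ j, z j : ℤ) : ℝ) = 0 := by
        push_cast
        rw [← hs]
        exact Finset.sum_congr rfl fun j _ => (hz j).symm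
      exact_mod_cast this
    -- Coordinate 0 of a grid point is always 0 and tests nothing, so divisibility of z 0 comes from
    -- the vanishing coordinate sum.
    have hdvd' : ∀ j, (N : ℤ) ∣ z j := by
      intro j
      refine Fin.cases ?_ hdvd j
      rw [Fin.sum_univ_succ] at hsz
      have : z 0 = -∑ i : Fin p, z i.succ := by linarith
      rw [this, dvd_neg]
      exact Finset.dvd_sum fun i _ => hdvd i
    choose v hv using hdvd'
    have hNz : (0 : ℤ) < N := by exact_mod_cast hN
    have hsv : ∑ j, v j = 0 := by
      have : (N : ℤ) * ∑ j, v j = 0 := by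
        rw [Finset.mul_sum, ← hsz]
        exact Finset.sum_congr rfl fun j _ => (hv j).symm
      exact (mul_eq_zero.mp this).resolve_left hNz.ne'
    have hvlt : ∀ j k, v j - v k < 2 := by
      intro j k
      have := hlt j k
      rw [hz, hz, hv, hv] at this
      have h3 : (N : ℤ) * v j - N * v k < 2 * N := by exact_mod_cast this
      by_contra h4
      nlinarith
    -- The entries of v differ by at most 1, so one positive entry would make all entries
    -- nonnegative, against the sum zero.
    have hv0 : ∀ j, v j ≤ 0 := by
      intro j
      by_contra hj
      have hnn : ∀ k, 0 ≤ v k := fun k => by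
        have := hvlt j k
        omega
      have := (Finset.sum_eq_zero_iff_of_nonneg fun k _ => hnn k).mp hsv j (Finset.mem_univ j)
      omega
    have hv1 : ∀ j, v j = 0 := fun j =>
      (Finset.sum_eq_zero_iff_of_nonpos fun k _ => hv0 k).mp hsv j (Finset.mem_univ j)
    apply h
    funext j
    rw [hz, hv, hv1]
    simp

/-- The signed number of permutations `π` with `κ ∘ π = -ν`. -/
def pairing {n : ℕ} (κ ν : Fin n → ℝ) : ℂ :=
  ∑ π : Equiv.Perm (Fin n), (Equiv.Perm.sign π : ℂ) * if κ ∘ π + ν = 0 then 1 else 0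

theorem permExp_eq_inv {n : ℕ} (κ ξ : Fin n → ℝ) (σ : Equiv.Perm (Fin n)) :
    permExp κ ξ σ = Complex.exp (Complex.I * ∑ k, ((ξ k * (κ ∘ ⇑(σ⁻¹)) k : ℝ) : ℂ)) := by
  rw [← permExp_comp_left κ ξ σ⁻¹ σ, mul_inv_cancel]
  rfl

theorem permExp_mul_permExp {n : ℕ} (κ ν ξ : Fin n → ℝ) (σ τ : Equiv.Perm (Fin n)) :
    permExp κ ξ σ * permExp ν ξ τ =
      Complex.exp (Complex.I * ∑ k, ((ξ k * (κ ∘ ⇑(σ⁻¹) + ν ∘ ⇑(τ⁻¹)) k : ℝ) : ℂ)) := by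
  rw [permExp_eq_inv, permExp_eq_inv, ← Complex.exp_add, ← mul_add, ← Finset.sum_add_distrib]
  congr 2
  refine Finset.sum_congr rfl fun k _ => ?_
  push_cast [Pi.add_apply]
  ring

/-- The substitution σ = τπ⁻¹ removes τ from both the condition and the sign, so each of the n!
choices of τ contributes the same amount. -/
theorem sum_sign_mul_sign {n : ℕ} (κ ν : Fin n → ℝ) :
    ∑ σ : Equiv.Perm (Fin n), ∑ τ : Equiv.Perm (Fin n),
      (Equiv.Perm.sign σ : ℂ) * (Equiv.Perm.sign τ : ℂ) *
        (if κ ∘ ⇑(σ⁻¹) + ν ∘ ⇑(τ⁻¹) = 0 then 1 else 0) =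
      (n ! : ℂ) * pairing κ ν := by
  rw [Finset.sum_comm]
  have h : ∀ τ : Equiv.Perm (Fin n), ∑ σ : Equiv.Perm (Fin n),
      (Equiv.Perm.sign σ : ℂ) * (Equiv.Perm.sign τ : ℂ) *
        (if κ ∘ ⇑(σ⁻¹) + ν ∘ ⇑(τ⁻¹) = 0 then 1 else 0) =
      pairing κ ν := by
    intro τ
    rw [pairing, ← Equiv.sum_comp ((Equiv.inv (Equiv.Perm (Fin n))).trans (Equiv.mulLeft τ))]
    refine Finset.sum_congr rfl fun π _ => ?_
    have hs : (Equiv.Perm.sign (((Equiv.inv (Equiv.Perm (Fin n))).trans (Equiv.mulLeft τ)) π) : ℂ) *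
        (Equiv.Perm.sign τ : ℂ) = (Equiv.Perm.sign π : ℂ) := by
      simp only [Equiv.trans_apply, Equiv.inv_apply, Equiv.coe_mulLeft, Equiv.Perm.sign_mul,
        Equiv.Perm.sign_inv]
      push_cast
      linear_combination (Equiv.Perm.sign π : ℂ) * sign_mul_self τ
    rw [hs]
    congr 1
    refine if_congr ?_ rfl rfl
    simp only [Equiv.trans_apply, Equiv.inv_apply, Equiv.coe_mulLeft, mul_inv_rev, inv_inv]
    constructor
    · intro h
      funext k
      have := congrFun h (τ k)
      simpa using this
    · intro h
      funext k
      have := congrFun h (τ⁻¹ k)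
      simpa using this
  rw [Finset.sum_congr rfl fun τ _ => h τ]
  simp [Fintype.card_perm]

/-- Integrality of the sums κ a + ν b makes every character in the expanded product well defined
modulo N, so character orthogonality applies term by term. -/
theorem sum_piFinset_altSum_mul_altSum {p N : ℕ} (hN : 0 < N) {r s : ℤ} {κ ν : Fin (p + 1) → ℝ}
    (hκ : WeightLE r κ) (hν : WeightLE s ν) (hrs : r + s < 2 * N)
    (hint : ∀ a b, ∃ z : ℤ, κ a + ν b = z) :
    ∑ d ∈ Fintype.piFinset fun _ : Fin p => Finset.range N,
      altSum κ (gridPoint N d) * altSum ν (gridPoint N d) =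
      ((p + 1)! : ℂ) * (N : ℂ) ^ p * pairing κ ν := by
  have h : ∀ σ τ : Equiv.Perm (Fin (p + 1)),
      ∑ d ∈ Fintype.piFinset fun _ : Fin p => Finset.range N,
        permExp κ (gridPoint N d) σ * permExp ν (gridPoint N d) τ =
      if κ ∘ ⇑(σ⁻¹) + ν ∘ ⇑(τ⁻¹) = 0
        then (N : ℂ) ^ p else 0 := by
    intro σ τ
    simp only [permExp_mul_permExp]
    have hw := (hκ.comp_perm σ⁻¹).add (hν.comp_perm τ⁻¹)
    refine sum_exp_gridPoint hN hw.1 (fun j => hint _ _) fun j k => (hw.sub_le j k).trans_lt ?_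
    exact_mod_cast hrs
  simp only [altSum, Finset.sum_mul_sum]
  rw [Finset.sum_comm]
  rw [Finset.sum_congr rfl fun σ _ => Finset.sum_comm]
  have h2 : ∀ σ τ : Equiv.Perm (Fin (p + 1)),
      ∑ d ∈ Fintype.piFinset fun _ : Fin p => Finset.range N,
        (Equiv.Perm.sign σ : ℂ) * permExp κ (gridPoint N d) σ *
          ((Equiv.Perm.sign τ : ℂ) * permExp ν (gridPoint N d) τ) =
      (N : ℂ) ^ p * ((Equiv.Perm.sign σ : ℂ) * (Equiv.Perm.sign τ : ℂ) *
        (if κ ∘ ⇑(σ⁻¹) + ν ∘ ⇑(τ⁻¹) = 0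
          then 1 else 0)) := by
    intro σ τ
    rw [Finset.sum_congr rfl fun d _ => mul_mul_mul_comm _ _ _ _, ← Finset.mul_sum, h]
    split_ifs <;> ring
  simp only [h2, ← Finset.mul_sum]
  rw [sum_sign_mul_sign]
  ring

/-- Permuting d permutes the last p coordinates of the grid point, and the two signs cancel in the
product. Terms with a repeated coordinate vanish. -/
theorem factorial_mul_sum_chains {p N : ℕ} (κ ν : Fin (p + 1) → ℝ) :
    ∑ d ∈ Fintype.piFinset fun _ : Fin p => Finset.range N,
      altSum κ (gridPoint N d) * altSum ν (gridPoint N d) =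
      (p ! : ℂ) * ∑ d ∈ chains p N, altSum κ (gridPoint N d) * altSum ν (gridPoint N d) := by
  rw [sum_piFinset_eq_factorial_mul]
  · congr 1
    symm
    refine Finset.sum_subset ?_ ?_
    · intro d hd
      rw [mem_chains] at hd
      simp only [Finset.mem_filter, Fintype.mem_piFinset, Finset.mem_range]
      exact ⟨fun j => (hd.1 j).2, hd.2⟩
    · intro d hd hd'
      simp only [Finset.mem_filter, Fintype.mem_piFinset, Finset.mem_range] at hd
      -- The cube allows d j = 0 while chains start at 1. Such an entry collides with the fixed
      -- coordinate 0, so the term still vanishes.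
      have : ∃ j, d j = 0 := by
        by_contra h
        push Not at h
        exact hd' (mem_chains.mpr ⟨fun j => ⟨Nat.pos_of_ne_zero (h j), hd.1 j⟩, hd.2⟩)
      obtain ⟨j, hj⟩ := this
      rw [altSum_eq_zero κ (Fin.succ_ne_zero j).symm, zero_mul]
      rw [gridPoint, simplexPoint_zero, simplexPoint_succ, hj]
      simp
  · intro d σ
    have : gridPoint N (d ∘ σ) = gridPoint N d ∘ Equiv.Perm.decomposeFin.symm (0, σ) :=
      simplexPoint_comp (fun i => (d i : ℝ) / N) σ
    rw [this, altSum_comp_right, altSum_comp_right, mul_mul_mul_comm, sign_mul_self, one_mul]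
  · intro d hd
    rw [Function.not_injective_iff] at hd
    obtain ⟨i, j, hij, hne⟩ := hd
    rw [altSum_eq_zero κ (i := i.succ) (j := j.succ) (by simpa using hne), zero_mul]
    rw [gridPoint, simplexPoint_succ, simplexPoint_succ, hij]

/-! ### Cyclic rotation of chains, for weights whose sum is not integral. -/

/-- Rotation of a set of residues modulo `N` that contains `0`, by its smallest positive element. -/
def rotateChain {q : ℕ} (N : ℕ) (d : Fin (q + 1) → ℕ) : Fin (q + 1) → ℕ :=
  fun j => (Fin.snoc (fun i : Fin q => d i.succ) N : Fin (q + 1) → ℕ) j - d 0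

theorem rotateChain_castSucc {q : ℕ} (N : ℕ) (d : Fin (q + 1) → ℕ) (i : Fin q) :
    rotateChain N d i.castSucc = d i.succ - d 0 := by
  simp [rotateChain]

theorem rotateChain_last {q : ℕ} (N : ℕ) (d : Fin (q + 1) → ℕ) :
    rotateChain N d (Fin.last q) = N - d 0 := by
  simp [rotateChain]

theorem rotateChain_mem {q N : ℕ} {d : Fin (q + 1) → ℕ} (hd : d ∈ chains (q + 1) N) :
    rotateChain N d ∈ chains (q + 1) N := by
  rw [mem_chains] at hd ⊢
  obtain ⟨h1, h2⟩ := hd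
  have h0 := h1 0
  constructor
  · intro j
    refine Fin.lastCases ?_ (fun i => ?_) j
    · rw [rotateChain_last]
      omega
    · rw [rotateChain_castSucc]
      have := h2 (Fin.succ_pos i)
      have := h1 i.succ
      omega
  · intro i j hij
    induction i using Fin.lastCases with
    | last => exact absurd hij (Fin.le_last j).not_gt
    | cast i =>
      rw [rotateChain_castSucc]
      have h3 := h2 (Fin.succ_pos i)
      have h4 := h1 i.succ
      induction j using Fin.lastCases with
      | last =>
        rw [rotateChain_last]
        omega
      | cast j =>
        rw [rotateChain_castSucc]
        have : d i.succ < d j.succ := h2 (by simpa using hij)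
        omega

theorem rotateChain_injOn (q N : ℕ) :
    Set.InjOn (rotateChain N) (chains (q + 1) N : Set (Fin (q + 1) → ℕ)) := by
  intro d hd e he hde
  rw [Finset.mem_coe, mem_chains] at hd he
  have h0 : d 0 = e 0 := by
    have := congrFun hde (Fin.last q)
    rw [rotateChain_last, rotateChain_last] at this
    have := hd.1 0
    have := he.1 0
    omega
  funext j
  refine Fin.cases h0 (fun i => ?_) j
  have := congrFun hde i.castSucc
  rw [rotateChain_castSucc, rotateChain_castSucc] at this
  have := hd.2 (Fin.succ_pos i)
  have := he.2 (Fin.succ_pos i)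
  omega

/-- An injective self-map of a finite set permutes it. -/
theorem sum_rotateChain {q N : ℕ} (F : (Fin (q + 1) → ℕ) → ℂ) :
    ∑ d ∈ chains (q + 1) N, F (rotateChain N d) = ∑ d ∈ chains (q + 1) N, F d := by
  have himg : (chains (q + 1) N).image (rotateChain N) = chains (q + 1) N := by
    refine Finset.eq_of_subset_of_card_le ?_ ?_
    · intro e he
      obtain ⟨d, hd, rfl⟩ := Finset.mem_image.mp he
      exact rotateChain_mem hd
    · rw [Finset.card_image_of_injOn (rotateChain_injOn q N)]
  conv_rhs => rw [← himg]
  rw [Finset.sum_image (rotateChain_injOn q N)]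

/-- Subtracting the smallest positive residue is a translation. The former coordinate 0 becomes the
last one and is moved by one period to stay in the simplex. -/
theorem gridPoint_rotateChain {q N : ℕ} (hN : 0 < N) {d : Fin (q + 1) → ℕ}
    (hd : d ∈ chains (q + 1) N) :
    gridPoint N (rotateChain N d) = fun j =>
      ((gridPoint N d ∘ finRotate (q + 2)) j + if j = Fin.last (q + 1) then -(2 * Real.pi) else 0) +
        2 * Real.pi * (d 0 : ℝ) / N := by
  rw [mem_chains] at hd
  have hN0 : (N : ℝ) ≠ 0 := by exact_mod_cast hN.ne'
  have h0 := hd.1 0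
  funext j
  refine Fin.lastCases ?_ (fun i => ?_) j
  · rw [← Fin.succ_last]
    simp only [gridPoint, simplexPoint_succ, rotateChain_last, Function.comp_apply, if_true]
    rw [Fin.succ_last, finRotate_last, simplexPoint_zero, Nat.cast_sub h0.2.le]
    field_simp
    ring
  · have hne : i.castSucc ≠ Fin.last (q + 1) := (Fin.castSucc_lt_last i).ne
    have hr : finRotate (q + 2) i.castSucc = i.succ := by
      rw [finRotate_apply, Fin.coeSucc_eq_succ]
    simp only [Function.comp_apply, hr, if_neg hne]
    refine Fin.cases ?_ (fun k => ?_) i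
    · simp only [gridPoint, Fin.castSucc_zero, simplexPoint_zero, simplexPoint_succ]
      ring
    · rw [Fin.castSucc_succ]
      simp only [gridPoint, simplexPoint_succ, rotateChain_castSucc]
      rw [Nat.cast_sub (hd.2 (Fin.succ_pos k)).le]
      ring

/-- All coordinates of κ agree modulo 1, so the shift by a period multiplies every exponential by
the same phase, whichever coordinate of κ it meets. -/
theorem altSum_sub_two_pi {p : ℕ} {r : ℤ} {κ : Fin (p + 1) → ℝ} (hκ : WeightLE r κ)
    (ξ : Fin (p + 1) → ℝ) (a : Fin (p + 1)) :
    altSum κ (fun j => ξ j + if j = a then -(2 * Real.pi) else 0) =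
      Complex.exp (-(2 * Real.pi * Complex.I) * κ 0) * altSum κ ξ := by
  simp only [altSum, Finset.mul_sum]
  refine Finset.sum_congr rfl fun σ _ => ?_
  have h : permExp κ (fun j => ξ j + if j = a then -(2 * Real.pi) else 0) σ =
      Complex.exp (-(2 * Real.pi * Complex.I) * κ 0) * permExp κ ξ σ := by
    obtain ⟨z, hz, -⟩ := hκ.2 (σ⁻¹ a) 0
    have hz' : κ (σ⁻¹ a) = κ 0 + z := by linarith
    have hsum : ∑ k, (ξ k + if k = a then -(2 * Real.pi) else 0) * (κ ∘ ⇑(σ⁻¹)) k =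
        (∑ k, ξ k * (κ ∘ ⇑(σ⁻¹)) k) + -(2 * Real.pi) * (κ 0 + z) := by
      simp only [add_mul, Finset.sum_add_distrib, ite_mul, zero_mul, Finset.sum_ite_eq',
        Finset.mem_univ, if_true, Function.comp_apply, hz']
    rw [permExp_eq_inv, permExp_eq_inv, ← Complex.ofReal_sum, ← Complex.ofReal_sum, hsum,
      ← Complex.exp_add, Complex.exp_eq_exp_iff_exists_int]
    refine ⟨-z, ?_⟩
    push_cast
    ring
  rw [h]
  ring

/-- Rotation of the chains multiplies the sum by exp(-2πi(κ 0 + ν 0)), the two permutation signs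
cancelling. This phase differs from 1 in the non-integral case. -/
theorem sum_chains_eq_zero {p N : ℕ} (hN : 0 < N) {r s : ℤ} {κ ν : Fin (p + 1) → ℝ}
    (hκ : WeightLE r κ) (hν : WeightLE s ν) (hint : ¬ ∃ z : ℤ, κ 0 + ν 0 = z) :
    ∑ d ∈ chains p N, altSum κ (gridPoint N d) * altSum ν (gridPoint N d) = 0 := by
  cases p with
  | zero =>
    refine absurd ⟨0, ?_⟩ hint
    have h1 := hκ.1
    have h2 := hν.1
    simp at h1 h2
    simp [h1, h2]
  | succ q =>
    set S := ∑ d ∈ chains (q + 1) N, altSum κ (gridPoint N d) * altSum ν (gridPoint N d) with hS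
    set ω : ℂ := Complex.exp (-(2 * Real.pi * Complex.I) * κ 0) *
      Complex.exp (-(2 * Real.pi * Complex.I) * ν 0) with hω
    have h : S = ω * S := by
      conv_lhs => rw [hS, ← sum_rotateChain]
      rw [hS, Finset.mul_sum]
      refine Finset.sum_congr rfl fun d hd => ?_
      rw [gridPoint_rotateChain hN hd, altSum_add_const hκ.1, altSum_add_const hν.1,
        altSum_sub_two_pi hκ, altSum_sub_two_pi hν, altSum_comp_right, altSum_comp_right, hω]
      linear_combination (Complex.exp (-(2 * Real.pi * Complex.I) * κ 0) *
        Complex.exp (-(2 * Real.pi * Complex.I) * ν 0) * altSum κ (gridPoint N d) *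
        altSum ν (gridPoint N d)) * sign_mul_self (finRotate (q + 2))
    have hω1 : ω ≠ 1 := by
      rw [hω, ← Complex.exp_add, Ne, Complex.exp_eq_one_iff]
      rintro ⟨z, hz⟩
      apply hint
      refine ⟨-z, ?_⟩
      have hpi : (2 * Real.pi * Complex.I : ℂ) ≠ 0 := Complex.two_pi_I_ne_zero
      have h3 : (2 * Real.pi * Complex.I : ℂ) * (κ 0 + ν 0 + z) = 0 := by linear_combination -hz
      have h4 : (κ 0 + ν 0 + z : ℂ) = 0 := (mul_eq_zero.mp h3).resolve_left hpi
      have h5 : κ 0 + ν 0 + z = 0 := by exact_mod_cast h4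
      push_cast
      linarith
    have : (ω - 1) * S = 0 := by linear_combination -h
    exact (mul_eq_zero.mp this).resolve_left (sub_ne_zero.mpr hω1)

/-- The integral case is the cube sum divided by p!. In the other case both sides vanish, since κ∘π
= -ν would make κ 0 + ν 0 an integer. -/
theorem sum_chains_altSum_mul_altSum {p N : ℕ} (hN : 0 < N) {r s : ℤ} {κ ν : Fin (p + 1) → ℝ}
    (hκ : WeightLE r κ) (hν : WeightLE s ν) (hrs : r + s < 2 * N) :
    ∑ d ∈ chains p N, altSum κ (gridPoint N d) * altSum ν (gridPoint N d) =
      ((p : ℂ) + 1) * (N : ℂ) ^ p * pairing κ ν := by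
  by_cases hint : ∃ z : ℤ, κ 0 + ν 0 = z
  · have hint' : ∀ a b, ∃ z : ℤ, κ a + ν b = z := by
      intro a b
      obtain ⟨z, hz⟩ := hint
      obtain ⟨x, hx, -⟩ := hκ.2 a 0
      obtain ⟨y, hy, -⟩ := hν.2 b 0
      exact ⟨z + x + y, by push_cast; linarith⟩
    have h := sum_piFinset_altSum_mul_altSum hN hκ hν hrs hint'
    rw [factorial_mul_sum_chains, Nat.factorial_succ] at h
    have hp : (p ! : ℂ) ≠ 0 := by exact_mod_cast Nat.factorial_ne_zero p
    refine mul_left_cancel₀ hp (h.trans ?_)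
    push_cast
    ring
  · rw [sum_chains_eq_zero hN hκ hν hint]
    have : pairing κ ν = 0 := by
      refine Finset.sum_eq_zero fun π _ => ?_
      rw [if_neg, mul_zero]
      intro h
      apply hint
      have h0 := congrFun h 0
      simp only [Pi.add_apply, Function.comp_apply, Pi.zero_apply] at h0
      obtain ⟨z, hz, -⟩ := hκ.2 0 (π 0)
      exact ⟨z, by linarith⟩
    rw [this, mul_zero]

/-! ### The Weyl denominator -/

section Denominator

variable {n : ℕ}

/-- `e^{-iξⱼ}`. -/
def expNeg (ξ : Fin n → ℝ) (j : Fin n) : ℂ := Complex.exp (-Complex.I * ξ j)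

/-- The unimodular factor relating `permExp (weylVector n) ξ σ` to a monomial in `expNeg ξ`. -/
def weylPhase (ξ : Fin n → ℝ) : ℂ := Complex.exp (Complex.I * ((((n : ℝ) - 1) / 2 * ∑ k, ξ k : ℝ) : ℂ))

/-- The component of ϱ at the zero-based index k is (n-1)/2 - k. Its constant part gives the phase,
and -k gives the Vandermonde exponent. -/
theorem permExp_weylVector (ξ : Fin n → ℝ) (σ : Equiv.Perm (Fin n)) :
    permExp (weylVector n) ξ σ = weylPhase ξ * ∏ k, expNeg ξ (σ k) ^ (k : ℕ) := by
  have h : ∏ k, expNeg ξ (σ k) ^ (k : ℕ) =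
      Complex.exp (∑ k : Fin n, ((k : ℕ) : ℂ) * (-Complex.I * ξ (σ k))) := by
    rw [Complex.exp_sum]
    exact Finset.prod_congr rfl fun k _ => (Complex.exp_nat_mul _ _).symm
  rw [h, permExp, weylPhase, ← Complex.exp_add, ← Equiv.sum_comp σ ξ]
  congr 1
  push_cast
  rw [Finset.mul_sum, Finset.mul_sum, Finset.mul_sum, ← Finset.sum_add_distrib]
  refine Finset.sum_congr rfl fun k _ => ?_
  simp only [weylVector]
  push_cast
  ring

theorem altSum_weylVector (ξ : Fin n → ℝ) :
    altSum (weylVector n) ξ =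
      weylPhase ξ * ∏ j, ∏ k ∈ Finset.Ioi j, (expNeg ξ k - expNeg ξ j) := by
  rw [← Matrix.det_vandermonde, Matrix.det_apply, Finset.mul_sum, altSum]
  refine Finset.sum_congr rfl fun σ _ => ?_
  rw [permExp_weylVector]
  simp only [Matrix.vandermonde_apply, Units.smul_def, zsmul_eq_mul]
  ring

theorem norm_weylPhase (ξ : Fin n → ℝ) : ‖weylPhase ξ‖ = 1 := by
  rw [weylPhase, mul_comm, Complex.norm_exp_ofReal_mul_I]

theorem norm_permExp (κ ξ : Fin n → ℝ) (σ : Equiv.Perm (Fin n)) : ‖permExp κ ξ σ‖ = 1 := by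
  rw [permExp, ← Complex.ofReal_sum, mul_comm, Complex.norm_exp_ofReal_mul_I]

/-- Clearing e^{-iξ_k} from each factor leaves the Vandermonde differences. No regularity of ξ is
needed: where a denominator vanishes, both sides are 0 by the convention for division. -/
theorem cFun_zero (ξ : Fin n → ℝ) :
    cFun 0 ξ = permExp (weylVector n) ξ 1 / altSum (weylVector n) ξ := by
  have h0 : weylPhase ξ ≠ 0 := Complex.exp_ne_zero _
  rw [permExp_weylVector, altSum_weylVector, mul_div_mul_left _ _ h0]
  have h1 : ∏ k, expNeg ξ ((1 : Equiv.Perm (Fin n)) k) ^ (k : ℕ) =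
      ∏ j : Fin n, ∏ k ∈ Finset.Ioi j, expNeg ξ k := by
    rw [Finset.prod_comm' (t' := Finset.univ) (s' := fun k => Finset.Iio k) (by simp)]
    refine Finset.prod_congr rfl fun k _ => ?_
    simp
  rw [h1, cFun, ← Finset.prod_div_distrib]
  refine Finset.prod_congr rfl fun j _ => ?_
  rw [← Finset.prod_div_distrib]
  refine Finset.prod_congr rfl fun k _ => ?_
  have hk : expNeg ξ k ≠ 0 := Complex.exp_ne_zero _
  have hj : Complex.exp (-Complex.I * (ξ j - ξ k)) = expNeg ξ j / expNeg ξ k := by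
    rw [expNeg, expNeg, ← Complex.exp_sub]
    congr 1
    ring
  rw [hj, Complex.ofReal_zero, zero_mul, sub_zero, one_sub_div hk, one_div_div]

theorem cueDensity_eq (ξ : Fin n → ℝ) :
    cueDensity ξ = ‖altSum (weylVector n) ξ‖ ^ 2 := by
  rw [altSum_weylVector, norm_mul, norm_weylPhase, one_mul, norm_prod, ← Finset.prod_pow,
    cueDensity]
  refine Finset.prod_congr rfl fun j _ => ?_
  rw [norm_prod, ← Finset.prod_pow]
  refine Finset.prod_congr rfl fun k _ => ?_
  have h : ∀ i, expNeg ξ i = (starRingEnd ℂ) (Complex.exp (Complex.I * ξ i)) := by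
    intro i
    rw [expNeg, ← Complex.exp_conj, map_mul, Complex.conj_I, Complex.conj_ofReal]
  rw [h, h, ← map_sub, Complex.norm_conj, norm_sub_rev]

theorem cueDensity_eq_mul (ξ : Fin n → ℝ) :
    (cueDensity ξ : ℂ) = altSum (weylVector n) ξ * altSum (-weylVector n) ξ := by
  rw [cueDensity_eq, ← conj_altSum, Complex.mul_conj, Complex.normSq_eq_norm_sq]

theorem norm_cFun_zero (ξ : Fin n → ℝ) :
    ‖cFun 0 ξ‖ = ‖altSum (weylVector n) ξ‖⁻¹ := by
  rw [cFun_zero, norm_div, norm_permExp, one_div]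

theorem inv_norm_cFun_zero_sq (ξ : Fin n → ℝ) : (‖cFun 0 ξ‖ ^ 2)⁻¹ = cueDensity ξ := by
  rw [norm_cFun_zero, cueDensity_eq, inv_pow, inv_inv]

/-- This is the Weyl character formula: permuting the argument of C only changes the sign of its
denominator. -/
theorem hallLittlewood_zero (μ ξ : Fin n → ℝ) :
    hallLittlewood 0 μ ξ = altSum (weylVector n + μ) ξ / altSum (weylVector n) ξ := by
  rw [hallLittlewood, altSum, Finset.sum_div]
  refine Finset.sum_congr rfl fun σ _ => ?_
  have h1 : cFun 0 (fun k => ξ (σ k)) =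
      (Equiv.Perm.sign σ : ℂ) * permExp (weylVector n) ξ σ / altSum (weylVector n) ξ := by
    change cFun 0 (ξ ∘ σ) = _
    rw [cFun_zero, altSum_comp_right, permExp_comp_right, mul_one]
    rcases Int.units_eq_one_or (Equiv.Perm.sign σ) with h | h <;> simp [h, div_neg, neg_div]
  rw [h1, ← permExp_mul]
  ring

/-- All exponents of q are positive because j < k in the first product and k < n in the second, so
each factor is 1/1. -/
theorem discreteWeight_zero (m : ℕ) (μ : Fin n → ℝ) : discreteWeight m 0 μ = 1 := by
  have h1 : ∀ j : Fin n, ∏ k ∈ Finset.Ioi j with μ j - μ k = 0,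
      (1 - (0 : ℝ) ^ ((k : ℕ) - (j : ℕ))) / (1 - (0 : ℝ) ^ (1 + (k : ℕ) - (j : ℕ))) = 1 := by
    intro j
    refine Finset.prod_eq_one fun k hk => ?_
    have hjk : j < k := by simpa using (Finset.mem_filter.mp hk).1
    have : (j : ℕ) < k := hjk
    rw [zero_pow (by omega), zero_pow (by omega)]
    norm_num
  have h2 : ∀ j : Fin n, ∏ k ∈ Finset.Ioi j with μ j - μ k = m,
      (1 - (0 : ℝ) ^ (n - (k : ℕ) + (j : ℕ))) / (1 - (0 : ℝ) ^ (n + 1 - (k : ℕ) + (j : ℕ))) = 1 := by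
    intro j
    refine Finset.prod_eq_one fun k _ => ?_
    have := k.isLt
    rw [zero_pow (by omega), zero_pow (by omega)]
    norm_num
  rw [discreteWeight, Finset.prod_congr rfl fun j _ => h1 j, Finset.prod_congr rfl fun j _ => h2 j]
  simp

theorem cueDensity_nonneg (ξ : Fin n → ℝ) : 0 ≤ cueDensity ξ := by
  rw [cueDensity_eq]
  positivity

theorem cueDensity_continuous : Continuous (cueDensity (n := n)) := by
  have : (cueDensity (n := n)) = fun ξ => ‖altSum (weylVector n) ξ‖ ^ 2 := by
    funext ξ
    exact cueDensity_eq ξ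
  rw [this]
  exact (altSum_continuous _).norm.pow 2

theorem cueDensity_pos {ξ : Fin n → ℝ} (hξ : ξ ∈ alcove n) : 0 < cueDensity ξ := by
  obtain ⟨-, h1, h2⟩ := hξ
  refine Finset.prod_pos fun j _ => Finset.prod_pos fun k hk => ?_
  have hjk : j < k := by simpa using hk
  refine pow_pos (norm_pos_iff.mpr (sub_ne_zero.mpr fun h => ?_)) 2
  rw [Complex.exp_eq_exp_iff_exists_int] at h
  obtain ⟨z, hz⟩ := h
  have h3 : ξ j = ξ k + z * (2 * Real.pi) := by
    have : (Complex.I : ℂ) * (ξ j - (ξ k + z * (2 * Real.pi))) = 0 := by linear_combination hz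
    have h4 := (mul_eq_zero.mp this).resolve_left Complex.I_ne_zero
    have h5 : ξ j - (ξ k + z * (2 * Real.pi)) = 0 := by exact_mod_cast h4
    linarith
  have h4 := h1 j k hjk
  have h5 := h2 j k
  have hpi := Real.pi_pos
  have h6 : (0 : ℝ) < z := by
    by_contra h
    push Not at h
    nlinarith
  have h7 : (z : ℝ) < 1 := by
    by_contra h
    push Not at h
    nlinarith
  have h8 : 0 < z := by exact_mod_cast h6
  have h9 : z < 1 := by exact_mod_cast h7
  omega

end Denominator

/-! ### The nodes -/

/-- The weight with label `d`. -/
def chainWeight {p : ℕ} (d : Fin p → ℕ) : Fin (p + 1) → ℝ :=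
  fun j => -(Fin.cons 0 (fun i => (d i : ℝ)) : Fin (p + 1) → ℝ) j + (∑ i, (d i : ℝ)) / ((p : ℝ) + 1) -
    weylVector (p + 1) j

theorem sum_chainWeight {p : ℕ} (d : Fin p → ℕ) : ∑ j, chainWeight d j = 0 := by
  simp only [chainWeight, Finset.sum_sub_distrib, Finset.sum_add_distrib, Finset.sum_neg_distrib,
    sum_weylVector, Fin.sum_cons, Finset.sum_const, Finset.card_univ, Fintype.card_fin,
    nsmul_eq_mul]
  push_cast
  have : (p : ℝ) + 1 ≠ 0 := by positivity
  field_simp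
  ring

theorem chainWeight_zero_sub_succ {p : ℕ} (d : Fin p → ℕ) (i : Fin p) :
    chainWeight d 0 - chainWeight d i.succ = (d i : ℝ) - ((i : ℕ) + 1) := by
  have := weylVector_sub (p + 1) 0 i.succ
  simp only [chainWeight, Fin.cons_zero, Fin.cons_succ]
  simp at this
  linarith

theorem chainWeight_mem {p m : ℕ} {d : Fin p → ℕ} (hd : d ∈ chains p (m + p + 1)) :
    chainWeight d ∈ dominantWeights m (p + 1) := by
  rw [mem_chains] at hd
  have hz : ∀ j, ∃ z : ℤ, chainWeight d 0 - chainWeight d j = z := by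
    intro j
    refine Fin.cases ⟨0, by simp⟩ (fun i => ⟨(d i : ℤ) - (i + 1), ?_⟩) j
    rw [chainWeight_zero_sub_succ]
    push_cast
    ring
  have ha : Antitone (chainWeight d) := by
    rw [Fin.antitone_iff_succ_le]
    intro i
    cases p with
    | zero => exact i.elim0
    | succ q =>
      have h1 := chainWeight_zero_sub_succ d i
      refine Fin.cases ?_ (fun k h1 => ?_) i h1
      · intro h1
        have h2 : (1 : ℝ) ≤ d 0 := by exact_mod_cast (hd.1 0).1
        simp only [Fin.val_zero, Fin.castSucc_zero] at h1 ⊢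
        push_cast at h1
        linarith
      · have h2 := chainWeight_zero_sub_succ d k.castSucc
        have h3 : d k.castSucc + 1 ≤ d k.succ := hd.2 (Fin.castSucc_lt_succ)
        have h4 : (d k.castSucc : ℝ) + 1 ≤ d k.succ := by exact_mod_cast h3
        rw [Fin.castSucc_succ]
        simp only [Fin.val_succ, Fin.val_castSucc] at h1 h2
        push_cast at h1
        linarith
  refine mem_dominantWeights_iff.mpr ⟨⟨sum_chainWeight d, fun j k => ?_⟩, ha⟩
  obtain ⟨a, ha'⟩ := hz j
  obtain ⟨b, hb⟩ := hz k
  refine ⟨b - a, by push_cast; linarith, ?_⟩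
  have h1 : chainWeight d 0 - chainWeight d (Fin.last p) ≤ m := by
    cases p with
    | zero => simp
    | succ q =>
      rw [← Fin.succ_last, chainWeight_zero_sub_succ]
      have h2 : d (Fin.last q) ≤ m + (q + 1) := by
        have := (hd.1 (Fin.last q)).2
        omega
      have h3 : (d (Fin.last q) : ℝ) ≤ m + (q + 1) := by exact_mod_cast h2
      simp only [Fin.val_last]
      linarith
  have h2 : chainWeight d j ≤ chainWeight d 0 := ha (Fin.zero_le j)
  have h3 : chainWeight d (Fin.last p) ≤ chainWeight d k := ha (Fin.le_last k)
  have h4 : ((b - a : ℤ) : ℝ) ≤ ((m : ℤ) : ℝ) := by push_cast; linarith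
  exact_mod_cast h4

theorem chainWeight_injective (p : ℕ) : Function.Injective (chainWeight (p := p)) := by
  intro d e h
  funext i
  have h1 := chainWeight_zero_sub_succ d i
  rw [h, chainWeight_zero_sub_succ] at h1
  have h2 : (d i : ℝ) = e i := by linarith
  exact_mod_cast h2

theorem exists_chainWeight_eq {p m : ℕ} {lam : Fin (p + 1) → ℝ}
    (hlam : lam ∈ dominantWeights m (p + 1)) :
    ∃ d ∈ chains p (m + p + 1), chainWeight d = lam := by
  obtain ⟨⟨hs, hd⟩, ha⟩ := mem_dominantWeights_iff.mp hlam
  have h : ∀ j, ∃ l : ℕ, lam 0 - lam j = l ∧ l ≤ m := by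
    intro j
    obtain ⟨z, hz, hzm⟩ := hd 0 j
    have h0 : (0 : ℝ) ≤ z := by
      rw [← hz, sub_nonneg]
      exact ha (Fin.zero_le j)
    obtain ⟨l, rfl⟩ := Int.eq_ofNat_of_zero_le (by exact_mod_cast h0 : (0 : ℤ) ≤ z)
    exact ⟨l, by simpa using hz, by exact_mod_cast hzm⟩
  choose l hl hlm using h
  -- Adding ϱ turns the weakly increasing differences lam 0 - lam j into strictly increasing ones.
  -- The index j = i + 1 explains the extra 1, and l ≤ m gives the upper bound m + p.
  refine ⟨fun i => l i.succ + i + 1, mem_chains.mpr ⟨fun i => ⟨by omega, ?_⟩, ?_⟩, ?_⟩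
  · have := hlm i.succ
    have := i.isLt
    omega
  · intro i j hij
    have h1 : lam j.succ ≤ lam i.succ := ha (Fin.succ_le_succ_iff.mpr hij.le)
    have h2 : (l i.succ : ℝ) ≤ l j.succ := by
      rw [← hl, ← hl]
      linarith
    have h3 : l i.succ ≤ l j.succ := by exact_mod_cast h2
    have h4 : (i : ℕ) < j := hij
    change l i.succ + i + 1 < l j.succ + j + 1
    omega
  · have hj : ∀ j, chainWeight (fun i : Fin p => l i.succ + i + 1) 0 -
        chainWeight (fun i : Fin p => l i.succ + i + 1) j = lam 0 - lam j := by
      intro j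
      refine Fin.cases (by simp) (fun i => ?_) j
      rw [chainWeight_zero_sub_succ, hl]
      push_cast
      ring
    refine eq_of_sum_eq_of_sub_eq ((sum_chainWeight _).trans hs.symm) fun i => ?_
    linarith [hj i.castSucc, hj i.succ]

theorem dominantWeightsFinset_eq_image (m p : ℕ) :
    dominantWeightsFinset m (p + 1) = (chains p (m + p + 1)).image chainWeight := by
  ext lam
  rw [dominantWeightsFinset, Set.Finite.mem_toFinset, Finset.mem_image]
  constructor
  · exact exists_chainWeight_eq
  · rintro ⟨d, hd, rfl⟩
    exact chainWeight_mem hd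

theorem card_dominantWeightsFinset (m p : ℕ) :
    (dominantWeightsFinset m (p + 1)).card = (m + p).choose m := by
  rw [dominantWeightsFinset_eq_image, Finset.card_image_of_injective _ (chainWeight_injective p),
    card_chains, Nat.add_sub_cancel]
  exact (Nat.choose_symm_add).symm

theorem schurNode_chainWeight (m p : ℕ) (d : Fin p → ℕ) :
    schurNode m (chainWeight d) = fun j => gridPoint (m + p + 1) d j +
      2 * Real.pi * ((∑ i, (d i : ℝ)) / ((p : ℝ) + 1)) / ((m : ℝ) + p + 1) := by
  funext j
  have h0 : (m : ℝ) + p + 1 ≠ 0 := by positivity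
  refine Fin.cases ?_ (fun i => ?_) j
  · simp only [schurNode, chainWeight, gridPoint, simplexPoint_zero, Fin.cons_zero]
    push_cast
    rw [← add_assoc]
    ring
  · simp only [schurNode, chainWeight, gridPoint, simplexPoint_succ, Fin.cons_succ]
    push_cast
    rw [← add_assoc]
    field_simp
    ring

/-- Nodes and grid points differ by multiples of (1, …, 1), which functions built from weights of
coordinate sum zero do not see. -/
theorem sum_schurNode {R : Type*} [AddCommMonoid R] (m p : ℕ) (F : (Fin (p + 1) → ℝ) → R)
    (hF : ∀ ξ c, F (fun j => ξ j + c) = F ξ) :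
    ∑ lam ∈ dominantWeightsFinset m (p + 1), F (schurNode m lam) =
      ∑ d ∈ chains p (m + p + 1), F (gridPoint (m + p + 1) d) := by
  rw [dominantWeightsFinset_eq_image,
    Finset.sum_image (chainWeight_injective p).injOn]
  refine Finset.sum_congr rfl fun d _ => ?_
  rw [schurNode_chainWeight, hF]

theorem weightLE_weylVector_add {p : ℕ} {D : ℤ} {μ : Fin (p + 1) → ℝ} (hμ : WeightLE D μ) :
    WeightLE (p + D) (weylVector (p + 1) + μ) := by
  refine WeightLE.add ?_ hμ
  have := weightLE_weylVector (p + 1)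
  push_cast at this
  simpa using this

theorem strictAnti_weylVector_add {n : ℕ} {μ : Fin n → ℝ} (hμ : Antitone μ) :
    StrictAnti (weylVector n + μ) := by
  intro j k hjk
  have h1 := weylVector_sub n j k
  have h2 : ((j : ℕ) : ℝ) < (k : ℕ) := by exact_mod_cast hjk
  have h3 := hμ hjk.le
  simp only [Pi.add_apply]
  linarith

theorem sum_schurNode_altSum_mul_altSum {p m : ℕ} {r s : ℤ} {κ ν : Fin (p + 1) → ℝ}
    (hκ : WeightLE r κ) (hν : WeightLE s ν) (hrs : r + s < 2 * (m + p + 1)) :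
    ∑ lam ∈ dominantWeightsFinset m (p + 1),
      altSum κ (schurNode m lam) * altSum ν (schurNode m lam) =
      ((p : ℂ) + 1) * ((p : ℂ) + 1 + m) ^ p * pairing κ ν := by
  rw [sum_schurNode m p (fun ξ => altSum κ ξ * altSum ν ξ)
    (fun ξ c => by rw [altSum_add_const hκ.1, altSum_add_const hν.1]),
    sum_chains_altSum_mul_altSum (Nat.succ_pos _) hκ hν (by push_cast; exact hrs)]
  congr 3
  push_cast
  ring

theorem pairing_neg_self {n : ℕ} {κ : Fin n → ℝ} (hκ : StrictAnti κ) : pairing κ (-κ) = 1 := by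
  rw [pairing, Finset.sum_eq_single 1]
  · simp
  · intro π _ hπ
    rw [if_neg, mul_zero]
    intro h
    apply hπ
    refine Equiv.ext fun k => hκ.injective ?_
    have := congrFun h k
    simp only [Pi.add_apply, Function.comp_apply, Pi.neg_apply, Pi.zero_apply] at this
    rw [Equiv.Perm.one_apply]
    linarith
  · simp

theorem sum_norm_altSum_sq {p m : ℕ} {lam : Fin (p + 1) → ℝ}
    (hlam : lam ∈ dominantWeights m (p + 1)) :
    ∑ μ ∈ dominantWeightsFinset m (p + 1),
      ‖altSum (weylVector (p + 1) + lam) (schurNode m μ)‖ ^ 2 =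
      ((p : ℝ) + 1) * ((p : ℝ) + 1 + m) ^ p := by
  obtain ⟨hw, ha⟩ := mem_dominantWeights_iff.mp hlam
  have hκ := weightLE_weylVector_add hw
  have h := sum_schurNode_altSum_mul_altSum (m := m) hκ hκ.neg (by linarith)
  rw [pairing_neg_self (strictAnti_weylVector_add ha), mul_one] at h
  apply Complex.ofReal_injective
  push_cast
  rw [← h]
  refine Finset.sum_congr rfl fun μ _ => ?_
  rw [← conj_altSum, Complex.mul_conj, Complex.normSq_eq_norm_sq]
  push_cast
  rfl

theorem permExp_smul_comm {n : ℕ} (c : ℝ) (κ ν : Fin n → ℝ) (σ : Equiv.Perm (Fin n)) :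
    permExp κ (c • ν) σ = permExp ν (c • κ) σ⁻¹ := by
  simp only [permExp]
  congr 2
  rw [← Equiv.sum_comp σ fun k => (((c • κ) (σ⁻¹ k) * ν k : ℝ) : ℂ)]
  refine Finset.sum_congr rfl fun k _ => ?_
  simp only [Pi.smul_apply, smul_eq_mul, ← Equiv.Perm.mul_apply, inv_mul_cancel,
    Equiv.Perm.one_apply]
  push_cast
  ring

/-- The pairing ⟨κ, ν_σ⟩ equals ⟨ν, κ_{σ⁻¹}⟩, and inversion preserves signs. Since the nodes are
multiples of ϱ + λ, this exchanges the roles of weight and node. -/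
theorem altSum_smul_comm {n : ℕ} (c : ℝ) (κ ν : Fin n → ℝ) :
    altSum κ (c • ν) = altSum ν (c • κ) := by
  simp only [altSum]
  rw [← Equiv.sum_comp (Equiv.inv (Equiv.Perm (Fin n)))
    fun σ => (Equiv.Perm.sign σ : ℂ) * permExp ν (c • κ) σ]
  refine Finset.sum_congr rfl fun σ _ => ?_
  rw [permExp_smul_comm, Equiv.inv_apply, Equiv.Perm.sign_inv]

theorem schurNode_eq_smul {n : ℕ} (m : ℕ) (lam : Fin n → ℝ) :
    schurNode m lam = (2 * Real.pi / ((m : ℝ) + n)) • (weylVector n + lam) := by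
  funext j
  simp only [schurNode, Pi.smul_apply, Pi.add_apply, smul_eq_mul]
  ring

theorem sum_schurNode_eq_zero {n : ℕ} (m : ℕ) {lam : Fin n → ℝ} (h : ∑ j, lam j = 0) :
    ∑ j, schurNode m lam j = 0 := by
  simp only [schurNode_eq_smul, Pi.smul_apply, Pi.add_apply, smul_eq_mul]
  rw [← Finset.mul_sum, Finset.sum_add_distrib, sum_weylVector, h]
  simp

theorem schurNode_mem_alcove {p m : ℕ} {lam : Fin (p + 1) → ℝ}
    (hlam : lam ∈ dominantWeights m (p + 1)) : schurNode m lam ∈ alcove (p + 1) := by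
  obtain ⟨hw, ha⟩ := mem_dominantWeights_iff.mp hlam
  have hc : 0 < 2 * Real.pi / ((m : ℝ) + (p + 1 : ℕ)) := by
    have := Real.pi_pos
    positivity
  refine ⟨sum_schurNode_eq_zero m hw.1, fun j k hjk => ?_, fun j k => ?_⟩
  · rw [schurNode_eq_smul]
    exact mul_lt_mul_of_pos_left (strictAnti_weylVector_add ha hjk) hc
  · have h1 := (weightLE_weylVector_add hw).sub_le j k
    have h2 : (weylVector (p + 1) + lam) j - (weylVector (p + 1) + lam) k <
        (m : ℝ) + (p + 1 : ℕ) := by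
      push_cast at h1 ⊢
      linarith
    have h3 := mul_lt_mul_of_pos_left h2 hc
    have h4 : (m : ℝ) + (p + 1 : ℕ) ≠ 0 := by positivity
    rw [div_mul_cancel₀ _ h4, mul_sub] at h3
    rw [schurNode_eq_smul]
    simp only [Pi.smul_apply, smul_eq_mul]
    linarith

/-- After the exchange of weight and node, the sum over weights at one node becomes the squared norm
of a single alternating sum over all nodes. The factor |A_ϱ|², nonzero in the alcove, cancels
against |C|². -/
theorem christoffel_zero {p m : ℕ} {lam : Fin (p + 1) → ℝ}
    (hlam : lam ∈ dominantWeights m (p + 1)) :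
    christoffel m 0 (schurNode m lam) = 1 / (((p : ℝ) + 1) * ((p : ℝ) + 1 + m) ^ p) := by
  set ξ := schurNode m lam with hξ
  have hpos := cueDensity_pos (schurNode_mem_alcove hlam)
  rw [cueDensity_eq, ← hξ] at hpos
  have h : ∀ μ, ‖hallLittlewood 0 μ ξ‖ ^ 2 * discreteWeight m 0 μ =
      ‖altSum (weylVector (p + 1) + lam) (schurNode m μ)‖ ^ 2 *
        (‖altSum (weylVector (p + 1)) ξ‖ ^ 2)⁻¹ := by
    intro μ
    rw [discreteWeight_zero, mul_one, hallLittlewood_zero, norm_div, div_pow, hξ,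
      schurNode_eq_smul, schurNode_eq_smul, altSum_smul_comm, div_eq_mul_inv]
  rw [christoffel, christoffelHat, norm_cFun_zero, Finset.sum_congr rfl fun μ _ => h μ,
    ← Finset.sum_mul, sum_norm_altSum_sq hlam, mul_inv, inv_inv, inv_pow, mul_left_comm,
    inv_mul_cancel₀ hpos.ne', mul_one, one_div]

/-! ### The Morse function -/

theorem sum_sum_Ioi_sub_mul_sub {n : ℕ} (x : Fin n → ℝ) :
    ∑ j, ∑ k ∈ Finset.Ioi j, (x j - x k) ^ 2 = n * ∑ j, x j ^ 2 - (∑ j, x j) ^ 2 := by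
  have h1 := Finset.sum_sum_Ioi_add_eq_sum_sum_off_diag fun j k : Fin n => (x j - x k) ^ 2
  have h2 : ∀ i : Fin n, ∑ j ∈ {i}ᶜ, (x j - x i) ^ 2 = ∑ j, (x j - x i) ^ 2 := by
    intro i
    refine Finset.sum_subset (Finset.subset_univ _) fun j _ hj => ?_
    have : j = i := by simpa using hj
    rw [this]
    ring
  have h3 : ∑ i, ∑ j, (x j - x i) ^ 2 = 2 * (n * ∑ j, x j ^ 2 - (∑ j, x j) ^ 2) := by
    have h4 : ∀ i j, (x j - x i) ^ 2 = x j ^ 2 - 2 * x i * x j + x i ^ 2 := fun i j => by ring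
    simp only [h4, Finset.sum_add_distrib, Finset.sum_sub_distrib, ← Finset.mul_sum,
      ← Finset.sum_mul, Finset.sum_const, Finset.card_univ, Fintype.card_fin, nsmul_eq_mul]
    ring
  simp only [h2] at h1
  rw [h3] at h1
  have h5 : ∀ i j : Fin n, (x j - x i) ^ 2 + (x i - x j) ^ 2 = 2 * (x i - x j) ^ 2 :=
    fun i j => by ring
  simp only [h5, ← Finset.mul_sum] at h1
  linarith

theorem morse_zero {n : ℕ} (m : ℕ) (lam ξ : Fin n → ℝ) :
    morse m 0 lam ξ = (∑ j, ∑ k ∈ Finset.Ioi j, (ξ j - ξ k) ^ 2) / 2 +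
      ∑ j, ((m : ℝ) / 2 * ξ j ^ 2 - 2 * Real.pi * (weylVector n j + lam j) * ξ j) := by
  have hv : ∀ x, vFun 0 x = x := by
    intro x
    simp [vFun, uFun]
  simp only [morse, hv, integral_id, Finset.sum_div]
  simp

/-- The function is quadratic, so its expansion at the critical point is exact. Criticality holds
because the pairwise term acts as multiplication by n on vectors of coordinate sum zero, which turns
the linear coefficient into (m + n) times the node. -/
theorem morse_zero_sub {n m : ℕ} (hn : 0 < n) {lam : Fin n → ℝ} (hlam : ∑ j, lam j = 0)
    (η : Fin n → ℝ) :
    morse m 0 lam η - morse m 0 lam (schurNode m lam) =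
      (m : ℝ) / 2 * ∑ j, (η j - schurNode m lam j) ^ 2 +
      (∑ j, ∑ k ∈ Finset.Ioi j,
        ((η j - schurNode m lam j) - (η k - schurNode m lam k)) ^ 2) / 2 := by
  set x := schurNode m lam with hx
  have hx0 : ∑ j, x j = 0 := sum_schurNode_eq_zero m hlam
  have hmn : (m : ℝ) + n ≠ 0 := by positivity
  have hxr : ∀ j, 2 * Real.pi * (weylVector n j + lam j) = ((m : ℝ) + n) * x j := by
    intro j
    rw [hx, schurNode]
    field_simp
  rw [morse_zero, morse_zero, sum_sum_Ioi_sub_mul_sub, sum_sum_Ioi_sub_mul_sub,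
    sum_sum_Ioi_sub_mul_sub fun j => η j - x j]
  simp only [hxr, sub_sq, Finset.sum_sub_distrib, Finset.sum_add_distrib, ← Finset.mul_sum,
    mul_assoc, hx0]
  have h1 : ∑ i, x i * x i = ∑ i, x i ^ 2 := Finset.sum_congr rfl fun i _ => by ring
  have h2 : ∑ i, η i * x i = ∑ i, x i * η i := Finset.sum_congr rfl fun i _ => by ring
  rw [h1, h2]
  ring

theorem isSpectralNode_zero_iff {n m : ℕ} (hn : 0 < n) (hm : 0 < m) {lam : Fin n → ℝ}
    (hlam : ∑ j, lam j = 0) (ξ : Fin n → ℝ) :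
    IsSpectralNode m 0 lam ξ ↔ ξ = schurNode m lam := by
  have h : IsSpectralNode m 0 lam (schurNode m lam) := by
    intro η hη
    rw [← sub_pos, morse_zero_sub hn hlam]
    -- The pairwise term is blind to translations along (1, …, 1). Strictness comes from the
    -- confining term, whose coefficient m/2 is positive.
    have h1 : 0 < ∑ j, (η j - schurNode m lam j) ^ 2 := by
      obtain ⟨j, hj⟩ := Function.ne_iff.mp hη
      refine Finset.sum_pos' (fun i _ => sq_nonneg _) ⟨j, Finset.mem_univ j, ?_⟩
      have := sub_ne_zero.mpr hj
      positivity
    have h2 : 0 ≤ ∑ j, ∑ k ∈ Finset.Ioi j,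
        ((η j - schurNode m lam j) - (η k - schurNode m lam k)) ^ 2 :=
      Finset.sum_nonneg fun j _ => Finset.sum_nonneg fun k _ => sq_nonneg _
    have hm' : (0 : ℝ) < m := by exact_mod_cast hm
    positivity
  constructor
  · intro hξ
    by_contra hne
    exact lt_asymm (hξ _ (Ne.symm hne)) (h _ hne)
  · rintro rfl
    exact h

/-! ### Riemann sums over the simplex `0 < x₁ < ⋯ < x_p < 1` -/

/-- The open simplex `0 < x₁ < ⋯ < x_p < 1`. -/
def simplex (p : ℕ) : Set (Fin p → ℝ) := {x | StrictMono x ∧ ∀ i, 0 < x i ∧ x i < 1}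

theorem convex_simplex (p : ℕ) : Convex ℝ (simplex p) := by
  intro x hx y hy a b ha hb hab
  refine ⟨fun i j hij => ?_, fun i => ?_⟩
  · have h1 := hx.1 hij
    have h2 := hy.1 hij
    simp only [Pi.add_apply, Pi.smul_apply, smul_eq_mul]
    rcases ha.eq_or_lt with rfl | ha'
    · have : b = 1 := by linarith
      subst this
      linarith
    · nlinarith [mul_lt_mul_of_pos_left h1 ha', mul_le_mul_of_nonneg_left h2.le hb]
  · exact convex_Ioo (0 : ℝ) 1 (hx.2 i) (hy.2 i) ha hb hab

theorem simplex_subset_Icc (p : ℕ) : simplex p ⊆ Set.Icc 0 1 :=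
  fun _ hx => ⟨fun i => (hx.2 i).1.le, fun i => (hx.2 i).2.le⟩

theorem measurableSet_simplex (p : ℕ) : MeasurableSet (simplex p) := by
  have : simplex p = (⋂ i, ⋂ j, ⋂ _ : i < j, {x | x i < x j}) ∩
      ⋂ i, {x | 0 < x i ∧ x i < 1} := by
    ext x
    simp [simplex, StrictMono]
  rw [this]
  refine MeasurableSet.inter ?_ ?_
  · refine MeasurableSet.iInter fun i => MeasurableSet.iInter fun j => MeasurableSet.iInter fun _ =>
      measurableSet_lt (measurable_pi_apply i) (measurable_pi_apply j)
  · refine MeasurableSet.iInter fun i => MeasurableSet.inter ?_ ?_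
    · exact measurableSet_lt measurable_const (measurable_pi_apply i)
    · exact measurableSet_lt (measurable_pi_apply i) measurable_const

theorem simplex_inter_grid (p N : ℕ) (hN : 0 < N) :
    simplex p ∩ ((N : ℝ)⁻¹ • Submodule.span ℤ (Set.range (Pi.basisFun ℝ (Fin p))) :
      Submodule ℤ (Fin p → ℝ)) =
      ((chains p N).image fun (d : Fin p → ℕ) (i : Fin p) => (d i : ℝ) / N : Finset (Fin p → ℝ)) := by
  have : NeZero N := ⟨hN.ne'⟩
  have hN0 : (0 : ℝ) < N := by exact_mod_cast hN
  ext x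
  rw [Set.mem_inter_iff, SetLike.mem_coe, BoxIntegral.unitPartition.mem_smul_span_iff,
    Finset.mem_coe, Finset.mem_image]
  constructor
  · rintro ⟨⟨h1, h2⟩, h3⟩
    have h4 : ∀ i, ∃ d : ℕ, x i = (d : ℝ) / N := by
      intro i
      obtain ⟨z, hz⟩ := h3 i
      simp only [algebraMap_int_eq, eq_intCast] at hz
      have h0 : (0 : ℝ) ≤ z := by
        rw [hz]
        exact mul_nonneg hN0.le (h2 i).1.le
      obtain ⟨l, rfl⟩ := Int.eq_ofNat_of_zero_le (by exact_mod_cast h0 : (0 : ℤ) ≤ z)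
      refine ⟨l, ?_⟩
      rw [eq_div_iff hN0.ne', mul_comm, ← hz]
      simp
    choose d hd using h4
    refine ⟨d, mem_chains.mpr ⟨fun i => ?_, fun i j hij => ?_⟩, ?_⟩
    · have h5 := h2 i
      rw [hd, lt_div_iff₀ hN0, div_lt_one hN0, zero_mul] at h5
      exact_mod_cast h5
    · have h5 := h1 hij
      rw [hd, hd, div_lt_div_iff_of_pos_right hN0] at h5
      exact_mod_cast h5
    · funext i
      exact (hd i).symm
  · rintro ⟨d, hd, rfl⟩
    rw [mem_chains] at hd
    refine ⟨⟨fun i j hij => ?_, fun i => ?_⟩, fun i => ⟨d i, ?_⟩⟩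
    · rw [div_lt_div_iff_of_pos_right hN0]
      exact_mod_cast hd.2 hij
    · rw [lt_div_iff₀ hN0, div_lt_one hN0, zero_mul]
      exact_mod_cast hd.1 i
    · simp only [algebraMap_int_eq, eq_intCast]
      push_cast
      field_simp

/-- Chains divided by N are exactly the points of the lattice ℤ^p/N in the open simplex. Convexity
makes the boundary of the simplex a null set, so Riemann sums converge. -/
theorem tendsto_sum_chains_real {p : ℕ} {F : (Fin p → ℝ) → ℝ} (hF : Continuous F) :
    Filter.Tendsto (fun N : ℕ => (∑ d ∈ chains p N, F fun i => (d i : ℝ) / N) / (N : ℝ) ^ p)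
      Filter.atTop (nhds (∫ x in simplex p, F x)) := by
  have h := tendsto_tsum_div_pow_atTop_integral (simplex p) F hF
    ((Metric.isBounded_Icc 0 1).subset (simplex_subset_Icc p)) (measurableSet_simplex p)
    ((convex_simplex p).addHaar_frontier volume)
  rw [Fintype.card_fin] at h
  refine h.congr' ?_
  filter_upwards [Filter.eventually_gt_atTop 0] with N hN
  congr 1
  have hN0 : (N : ℝ) ≠ 0 := by exact_mod_cast hN.ne'
  have hinj : Function.Injective fun (d : Fin p → ℕ) (i : Fin p) => (d i : ℝ) / N := by
    intro d e hde
    funext i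
    have := congrFun hde i
    simp only at this
    rw [div_left_inj' hN0] at this
    exact_mod_cast this
  rw [← Finset.sum_image (f := F) (g := fun (d : Fin p → ℕ) (i : Fin p) => (d i : ℝ) / N)
    hinj.injOn, ← Finset.tsum_subtype' _ F, ← simplex_inter_grid p N hN]
  rfl

theorem integrableOn_simplex {p : ℕ} {F : (Fin p → ℝ) → ℂ} (hF : Continuous F) :
    IntegrableOn F (simplex p) :=
  (hF.continuousOn.integrableOn_compact isCompact_Icc).mono_set (simplex_subset_Icc p)

theorem tendsto_sum_chains {p : ℕ} {F : (Fin p → ℝ) → ℂ} (hF : Continuous F) :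
    Filter.Tendsto (fun N : ℕ => (∑ d ∈ chains p N, F fun i => (d i : ℝ) / N) / (N : ℂ) ^ p)
      Filter.atTop (nhds (∫ x in simplex p, F x)) := by
  have h1 := tendsto_sum_chains_real (Complex.continuous_re.comp hF)
  have h2 := tendsto_sum_chains_real (Complex.continuous_im.comp hF)
  have h3 := integral_re_add_im (integrableOn_simplex hF)
  rw [← h3]
  refine (((Complex.continuous_ofReal.tendsto _).comp h1).add
    (((Complex.continuous_ofReal.tendsto _).comp h2).mul_const Complex.I)).congr fun N => ?_
  simp only [Function.comp_apply]
  push_cast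
  rw [div_mul_eq_mul_div, ← add_div, Finset.sum_mul, ← Finset.sum_add_distrib]
  congr 1
  exact Finset.sum_congr rfl fun d _ => Complex.re_add_im _

/-! ### The Lebesgue measure of the hyperplane in coordinates -/

/-- The projection of `simplexPoint x` to the hyperplane. -/
def planePoint {p : ℕ} (x : Fin p → ℝ) : Fin (p + 1) → ℝ :=
  fun j => simplexPoint x j + 2 * Real.pi * (∑ i, x i) / ((p : ℝ) + 1)

theorem planePoint_zero_sub_succ {p : ℕ} (x : Fin p → ℝ) (i : Fin p) :
    planePoint x 0 - planePoint x i.succ = 2 * Real.pi * x i := by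
  simp only [planePoint, simplexPoint_zero, simplexPoint_succ]
  ring

theorem sum_planePoint {p : ℕ} (x : Fin p → ℝ) : ∑ j, planePoint x j = 0 := by
  simp only [planePoint, Finset.sum_add_distrib, Fin.sum_univ_succ, simplexPoint_zero,
    simplexPoint_succ, ← Finset.mul_sum, Finset.sum_const, Finset.card_univ, Fintype.card_fin,
    nsmul_eq_mul]
  have : (p : ℝ) + 1 ≠ 0 := by positivity
  push_cast
  field_simp
  ring

/-- `planePoint` as a linear equivalence. -/
def planeEquiv (p : ℕ) : (Fin p → ℝ) ≃ₗ[ℝ] hyperplane (p + 1) where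
  toFun x := ⟨WithLp.toLp 2 (planePoint x), sum_planePoint x⟩
  invFun y i := (hyperplaneIncl (p + 1) y 0 - hyperplaneIncl (p + 1) y i.succ) / (2 * Real.pi)
  map_add' x y := by
    ext j
    refine Fin.cases ?_ (fun i => ?_) j
    · simp [planePoint, simplexPoint_zero, Finset.sum_add_distrib]
      ring
    · simp [planePoint, simplexPoint_succ, Finset.sum_add_distrib]
      ring
  map_smul' c x := by
    ext j
    refine Fin.cases ?_ (fun i => ?_) j
    · simp [planePoint, simplexPoint_zero, ← Finset.mul_sum]
      ring
    · simp [planePoint, simplexPoint_succ, ← Finset.mul_sum]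
      ring
  left_inv x := by
    funext i
    have hpi := Real.two_pi_pos.ne'
    simp only [hyperplaneIncl]
    rw [planePoint_zero_sub_succ, mul_div_cancel_left₀ _ hpi]
  right_inv y := by
    have hpi := Real.pi_ne_zero
    ext j
    simp only
    set x : Fin p → ℝ := fun i =>
      (hyperplaneIncl (p + 1) y 0 - hyperplaneIncl (p + 1) y i.succ) / (2 * Real.pi) with hx
    have h : planePoint x = hyperplaneIncl (p + 1) y := by
      have hj : ∀ j, planePoint x 0 - planePoint x j =
          hyperplaneIncl (p + 1) y 0 - hyperplaneIncl (p + 1) y j := by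
        intro j
        refine Fin.cases (by simp) (fun i => ?_) j
        rw [planePoint_zero_sub_succ, hx]
        field_simp
      refine eq_of_sum_eq_of_sub_eq ((sum_planePoint x).trans y.2.symm) fun i => ?_
      linarith [hj i.castSucc, hj i.succ]
    exact congrFun h j

theorem finrank_hyperplane (p : ℕ) : Module.finrank ℝ (hyperplane (p + 1)) = p := by
  rw [← (planeEquiv p).finrank_eq]
  simp

/-- An orthonormal basis of the hyperplane. -/
def planeBasis (p : ℕ) : OrthonormalBasis (Fin p) ℝ (hyperplane (p + 1)) :=
  (stdOrthonormalBasis ℝ (hyperplane (p + 1))).reindex (finCongr (finrank_hyperplane p))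

/-- The Gram matrix of the simplex coordinates is computed from their ambient vectors. Since one
factor already has coordinate sum zero, the projection may be dropped from the other. -/
theorem inner_planeEquiv_single {p : ℕ} (j k : Fin p) :
    inner ℝ (planeEquiv p (Pi.single j 1)) (planeEquiv p (Pi.single k 1)) =
      (2 * Real.pi) ^ 2 * ((if j = k then 1 else 0) - 1 / ((p : ℝ) + 1)) := by
  have h0 : (p : ℝ) + 1 ≠ 0 := by positivity
  have h : inner ℝ (planeEquiv p (Pi.single j 1)) (planeEquiv p (Pi.single k 1)) =
      ∑ a, planePoint (Pi.single k (1 : ℝ)) a * planePoint (Pi.single j (1 : ℝ)) a := by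
    rw [Submodule.coe_inner, PiLp.inner_apply]
    rfl
  have hs : ∀ i : Fin p, ∑ a, (Pi.single i (1 : ℝ) : Fin p → ℝ) a = 1 := fun i => by simp
  have h1 : ∑ a, planePoint (Pi.single k (1 : ℝ)) a * planePoint (Pi.single j (1 : ℝ)) a =
      ∑ a, planePoint (Pi.single k (1 : ℝ)) a * simplexPoint (Pi.single j (1 : ℝ)) a := by
    simp only [planePoint.eq_def (Pi.single j (1 : ℝ)), mul_add, Finset.sum_add_distrib,
      ← Finset.sum_mul, sum_planePoint]
    ring
  rw [h, h1, Fin.sum_univ_succ]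
  simp only [planePoint, simplexPoint_zero, simplexPoint_succ, hs, add_mul,
    Finset.sum_add_distrib, ← Finset.mul_sum]
  have h2 : ∑ i, -(2 * Real.pi) * (Pi.single k (1 : ℝ) : Fin p → ℝ) i *
      (-(2 * Real.pi) * (Pi.single j (1 : ℝ) : Fin p → ℝ) i) =
      (2 * Real.pi) ^ 2 * (if j = k then 1 else 0) := by
    rw [Finset.sum_eq_single j]
    · rw [Pi.single_eq_same, Pi.single_apply]
      ring
    · intro b _ hb
      rw [Pi.single_eq_of_ne hb]
      ring
    · simp
  rw [h2]
  field_simp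
  ring

/-- The linear map `planeEquiv` in the coordinates of an orthonormal basis. -/
def planeCoord (p : ℕ) : (Fin p → ℝ) →ₗ[ℝ] (Fin p → ℝ) :=
  (WithLp.linearEquiv 2 ℝ (Fin p → ℝ)).toLinearMap ∘ₗ
    (planeBasis p).repr.toLinearEquiv.toLinearMap ∘ₗ (planeEquiv p).toLinearMap

theorem det_planeCoord_sq (p : ℕ) :
    LinearMap.det (planeCoord p) ^ 2 = (2 * Real.pi) ^ (2 * p) / ((p : ℝ) + 1) := by
  have h0 : (p : ℝ) + 1 ≠ 0 := by positivity
  set A := LinearMap.toMatrix' (planeCoord p) with hA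
  have hdet : LinearMap.det (planeCoord p) = A.det := by
    rw [hA, LinearMap.det_toMatrix']
  -- The Gram matrix is a multiple of a rank-one perturbation of the identity, whose determinant is
  -- 1 - p/(p+1).
  have hG : A.transpose * A = (2 * Real.pi) ^ 2 •
      (1 + Matrix.replicateCol Unit (fun _ : Fin p => -(1 / ((p : ℝ) + 1))) *
        Matrix.replicateRow Unit (fun _ : Fin p => (1 : ℝ))) := by
    ext j k
    have hent : ∀ i k, A i k = inner ℝ (planeBasis p i) (planeEquiv p (Pi.single k 1)) := by
      intro i k
      rw [hA, LinearMap.toMatrix'_apply, ← OrthonormalBasis.repr_apply_apply]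
      simp only [planeCoord, LinearMap.comp_apply]
      rfl
    simp only [Matrix.mul_apply, Matrix.transpose_apply, hent]
    have := (planeBasis p).sum_inner_mul_inner (planeEquiv p (Pi.single j 1))
      (planeEquiv p (Pi.single k 1))
    rw [inner_planeEquiv_single] at this
    have hsymm : ∀ i, inner ℝ (planeBasis p i) (planeEquiv p (Pi.single j 1)) =
        inner ℝ (planeEquiv p (Pi.single j 1)) (planeBasis p i) := fun i => real_inner_comm _ _
    simp only [hsymm, this, Matrix.smul_apply, Matrix.add_apply, Matrix.one_apply,
      Matrix.mul_apply, Matrix.replicateCol_apply, Matrix.replicateRow_apply, Finset.sum_const,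
      Finset.card_univ, Fintype.card_unit, smul_eq_mul, one_smul, mul_one, sub_eq_add_neg]
  have h1 : A.det ^ 2 = (A.transpose * A).det := by
    rw [Matrix.det_mul, Matrix.det_transpose, sq]
  rw [hdet, h1, hG, Matrix.det_smul, Matrix.det_one_add_replicateCol_mul_replicateRow,
    Fintype.card_fin, ← pow_mul]
  simp only [dotProduct, one_mul, Finset.sum_const, Finset.card_univ, Fintype.card_fin,
    nsmul_eq_mul]
  field_simp
  ring

theorem abs_det_planeCoord (p : ℕ) :
    |LinearMap.det (planeCoord p)| = (2 * Real.pi) ^ p / Real.sqrt ((p : ℝ) + 1) := by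
  have hpi := Real.two_pi_pos
  rw [← Real.sqrt_sq_eq_abs, det_planeCoord_sq, Real.sqrt_div (by positivity), mul_comm 2 p,
    pow_mul, Real.sqrt_sq (by positivity)]

/-- In an orthonormal basis of the hyperplane the coordinate map is an endomorphism of ℝ^p, so the
density is its Jacobian. -/
theorem hyperplaneVolume_eq (p : ℕ) :
    hyperplaneVolume (p + 1) =
      ENNReal.ofReal ((2 * Real.pi) ^ p / Real.sqrt ((p : ℝ) + 1)) •
        Measure.map planePoint (volume : Measure (Fin p → ℝ)) := by
  have hpi := Real.two_pi_pos
  have hc : 0 < (2 * Real.pi) ^ p / Real.sqrt ((p : ℝ) + 1) := by positivity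
  have hdet : LinearMap.det (planeCoord p) ≠ 0 := by
    rw [← abs_pos, abs_det_planeCoord]
    exact hc
  set V : Measure (hyperplane (p + 1)) :=
    @volume (hyperplane (p + 1)) (measureSpaceOfInnerProductSpace (E := hyperplane (p + 1))) with hV
  let P : hyperplane (p + 1) ≃ᵐ (Fin p → ℝ) :=
    (planeBasis p).measurableEquiv.trans (MeasurableEquiv.toLp 2 (Fin p → ℝ)).symm
  have hP : Measure.map P V = volume :=
    ((EuclideanSpace.volume_preserving_symm_measurableEquiv_toLp (Fin p)).comp
      (planeBasis p).measurePreserving_measurableEquiv).map_eq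
  have hE : Measurable (planeEquiv p) :=
    (planeEquiv p).toContinuousLinearEquiv.continuous.measurable
  have h1 : Measure.map (planeCoord p) volume =
      Measure.map P (Measure.map (planeEquiv p) volume) := by
    rw [Measure.map_map P.measurable hE]
    rfl
  have h2 : Measure.map (planeEquiv p) volume =
      ENNReal.ofReal |(LinearMap.det (planeCoord p))⁻¹| • V := by
    apply P.map_measurableEquiv_injective
    rw [← h1, Measure.map_smul, hP, Measure.map_linearMap_addHaar_eq_smul_addHaar _ hdet]
  have h3 : V = ENNReal.ofReal ((2 * Real.pi) ^ p / Real.sqrt ((p : ℝ) + 1)) •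
      Measure.map (planeEquiv p) volume := by
    rw [h2, smul_smul, ← ENNReal.ofReal_mul hc.le, abs_inv, abs_det_planeCoord,
      mul_inv_cancel₀ hc.ne', ENNReal.ofReal_one, one_smul]
  rw [hyperplaneVolume, ← hV, h3, Measure.map_smul,
    Measure.map_map (measurable_hyperplaneIncl _) hE]
  rfl

theorem planePoint_sub {p : ℕ} (x : Fin p → ℝ) (j k : Fin (p + 1)) :
    planePoint x j - planePoint x k = 2 * Real.pi *
      ((Fin.cons 0 x : Fin (p + 1) → ℝ) k - (Fin.cons 0 x : Fin (p + 1) → ℝ) j) := by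
  simp only [planePoint, simplexPoint]
  ring

theorem planePoint_mem_alcove_iff {p : ℕ} {x : Fin p → ℝ} :
    planePoint x ∈ alcove (p + 1) ↔ x ∈ simplex p := by
  have hpi := Real.two_pi_pos
  have hlt : ∀ j k, planePoint x k < planePoint x j ↔
      (Fin.cons 0 x : Fin (p + 1) → ℝ) j < (Fin.cons 0 x : Fin (p + 1) → ℝ) k := by
    intro j k
    rw [← sub_pos, planePoint_sub, mul_pos_iff_of_pos_left hpi, sub_pos]
  have hlt2 : ∀ j k, planePoint x j - 2 * Real.pi < planePoint x k ↔
      (Fin.cons 0 x : Fin (p + 1) → ℝ) k - (Fin.cons 0 x : Fin (p + 1) → ℝ) j < 1 := by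
    intro j k
    have := planePoint_sub x j k
    constructor
    · intro h
      by_contra h'
      push Not at h'
      nlinarith
    · intro h
      nlinarith
  constructor
  · rintro ⟨-, h1, h2⟩
    refine ⟨fun i j hij => ?_, fun i => ⟨?_, ?_⟩⟩
    · simpa using (hlt _ _).mp (h1 i.succ j.succ (Fin.succ_lt_succ_iff.mpr hij))
    · simpa using (hlt _ _).mp (h1 0 i.succ (Fin.succ_pos i))
    · simpa using (hlt2 _ _).mp (h2 0 i.succ)
  · rintro ⟨h1, h2⟩
    refine ⟨sum_planePoint x, fun j k => ?_, fun j k => ?_⟩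
    · rw [hlt]
      induction j using Fin.cases with
      | zero =>
        induction k using Fin.cases with
        | zero => simp
        | succ k => simpa using (h2 k).1
      | succ j =>
        induction k using Fin.cases with
        | zero => simp
        | succ k => simpa using fun h => h1 h
    · rw [hlt2]
      induction j using Fin.cases with
      | zero =>
        induction k using Fin.cases with
        | zero => simp
        | succ k => simpa using (h2 k).2
      | succ j =>
        induction k using Fin.cases with
        | zero =>
          have := (h2 j).1
          simp
          linarith
        | succ k =>
          have := (h2 j).1
          have := (h2 k).2
          simp
          linarith

theorem continuous_simplexPoint (p : ℕ) : Continuous (simplexPoint (p := p)) := by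
  refine continuous_pi fun j => ?_
  refine Fin.cases ?_ (fun i => ?_) j
  · simp only [simplexPoint_zero]
    exact continuous_const
  · simp only [simplexPoint_succ]
    fun_prop

theorem continuous_planePoint (p : ℕ) : Continuous (planePoint (p := p)) := by
  refine continuous_pi fun j => ?_
  have := (continuous_apply j).comp (continuous_simplexPoint p)
  simp only [Function.comp_def] at this
  unfold planePoint
  fun_prop

theorem measurableSet_alcove (n : ℕ) : MeasurableSet (alcove n) := by
  have : alcove n = {ξ | ∑ j, ξ j = 0} ∩ ((⋂ j, ⋂ k, ⋂ _ : j < k, {ξ | ξ k < ξ j}) ∩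
      ⋂ j, ⋂ k, {ξ | ξ j - 2 * Real.pi < ξ k}) := by
    ext ξ
    simp [alcove]
  rw [this]
  refine MeasurableSet.inter ?_ (MeasurableSet.inter ?_ ?_)
  · exact measurableSet_eq_fun (by fun_prop) measurable_const
  · exact MeasurableSet.iInter fun j => MeasurableSet.iInter fun k => MeasurableSet.iInter fun _ =>
      measurableSet_lt (measurable_pi_apply k) (measurable_pi_apply j)
  · exact MeasurableSet.iInter fun j => MeasurableSet.iInter fun k =>
      measurableSet_lt (by fun_prop) (measurable_pi_apply k)

theorem preimage_alcove (p : ℕ) : planePoint ⁻¹' alcove (p + 1) = simplex p :=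
  Set.ext fun _ => planePoint_mem_alcove_iff

theorem integrableOn_alcove {p : ℕ} {g : (Fin (p + 1) → ℝ) → ℂ} (hg : Continuous g) :
    IntegrableOn g (alcove (p + 1)) (hyperplaneVolume (p + 1)) := by
  rw [IntegrableOn, hyperplaneVolume_eq, Measure.restrict_smul]
  refine Integrable.smul_measure ?_ ENNReal.ofReal_ne_top
  rw [Measure.restrict_map (continuous_planePoint p).measurable (measurableSet_alcove _),
    preimage_alcove, integrable_map_measure hg.aestronglyMeasurable
      (continuous_planePoint p).measurable.aemeasurable]
  exact integrableOn_simplex (hg.comp (continuous_planePoint p))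

theorem setIntegral_alcove {p : ℕ} {g : (Fin (p + 1) → ℝ) → ℂ} (hg : Continuous g) :
    ∫ ξ in alcove (p + 1), g ξ ∂(hyperplaneVolume (p + 1)) =
      (((2 * Real.pi) ^ p / Real.sqrt ((p : ℝ) + 1) : ℝ) : ℂ) *
        ∫ x in simplex p, g (planePoint x) := by
  have hpi := Real.two_pi_pos
  rw [hyperplaneVolume_eq, Measure.restrict_smul, integral_smul_measure,
    setIntegral_map (measurableSet_alcove _) hg.aestronglyMeasurable
      (continuous_planePoint p).measurable.aemeasurable, preimage_alcove,
    ENNReal.toReal_ofReal (by positivity), Complex.real_smul]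

/-- The Jacobian and the normalization leave only the factor 1/n, and translation invariance
replaces the projected point by the unprojected one. -/
theorem cueIntegral_eq {p : ℕ} {f : (Fin (p + 1) → ℝ) → ℂ} (hf : Continuous f)
    (hconst : ∀ ξ c, f (fun j => ξ j + c) = f ξ) :
    cueIntegral (p + 1) f = (1 / ((p : ℂ) + 1)) *
      ∫ x in simplex p, f (simplexPoint x) * (cueDensity (simplexPoint x) : ℂ) := by
  have hpi := Real.two_pi_pos
  have hρ : Continuous fun ξ : Fin (p + 1) → ℝ => f ξ * (cueDensity ξ : ℂ) :=
    hf.mul (Complex.continuous_ofReal.comp cueDensity_continuous)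
  rw [cueIntegral, setIntegral_alcove hρ, ← mul_assoc, ← Complex.ofReal_mul]
  have hc : 1 / ((2 * Real.pi) ^ (p + 1 - 1) * Real.sqrt ((p + 1 : ℕ) : ℝ)) *
      ((2 * Real.pi) ^ p / Real.sqrt ((p : ℝ) + 1)) = 1 / ((p : ℝ) + 1) := by
    have h1 : (0 : ℝ) < (p : ℝ) + 1 := by positivity
    have h2 : Real.sqrt ((p : ℝ) + 1) * Real.sqrt ((p : ℝ) + 1) = (p : ℝ) + 1 :=
      Real.mul_self_sqrt h1.le
    have h3 : (2 * Real.pi) ^ p ≠ 0 := by positivity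
    have h4 : Real.sqrt ((p : ℝ) + 1) ≠ 0 := by positivity
    push_cast
    rw [div_mul_div_comm, one_mul, mul_assoc, h2, div_mul_cancel_left₀ h3, one_div]
  rw [hc]
  push_cast
  congr 1
  refine integral_congr_ae (Filter.Eventually.of_forall fun x => ?_)
  have h1 : f (planePoint x) = f (simplexPoint x) := hconst _ _
  have h2 : cueDensity (planePoint x) = cueDensity (simplexPoint x) := by
    rw [cueDensity_eq, cueDensity_eq, ← altSum_add_const (sum_weylVector (p + 1)) (simplexPoint x)]
    rfl
  simp only [h1, h2]

/-! ### The cubature rule -/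

theorem continuous_of_mem_symmPoly {p D : ℕ} {f : (Fin (p + 1) → ℝ) → ℂ}
    (hf : f ∈ symmPoly D (p + 1)) : Continuous f := by
  rw [symmPoly_eq_span] at hf
  induction hf using Submodule.span_induction with
  | mem x h =>
    obtain ⟨κ, -, rfl⟩ := h
    exact orbitSum_continuous κ
  | zero => exact continuous_const
  | add x y _ _ hx hy => exact hx.add hy
  | smul a x _ hx => exact continuous_const.mul hx

theorem sum_schurNode_orbitSum {p m D : ℕ} {μ : Fin (p + 1) → ℝ} (hμ : WeightLE D μ)
    (hD : D ≤ 2 * m + 1) :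
    ∑ lam ∈ dominantWeightsFinset m (p + 1),
      orbitSum μ (schurNode m lam) * (cueDensity (schurNode m lam) : ℂ) =
      ((p : ℂ) + 1) * ((p : ℂ) + 1 + m) ^ p *
        ∑ π : Equiv.Perm (Fin (p + 1)),
          pairing (weylVector (p + 1) + μ ∘ π) (-weylVector (p + 1)) := by
  have hρ : WeightLE (p : ℤ) (weylVector (p + 1)) := by
    simpa using weightLE_weylVector (p + 1)
  simp only [cueDensity_eq_mul, ← mul_assoc, orbitSum_mul_altSum, Finset.sum_mul]
  rw [Finset.sum_comm, Finset.mul_sum]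
  refine Finset.sum_congr rfl fun π _ => ?_
  exact sum_schurNode_altSum_mul_altSum (weightLE_weylVector_add (hμ.comp_perm π)) hρ.neg
    (by omega)

/-- The normalized Riemann sums are eventually constant by discrete orthogonality, so their limit
equals that constant. -/
theorem integral_simplex_orbitSum {p D : ℕ} {μ : Fin (p + 1) → ℝ} (hμ : WeightLE D μ) :
    ∫ x in simplex p, orbitSum μ (simplexPoint x) * (cueDensity (simplexPoint x) : ℂ) =
      ((p : ℂ) + 1) * ∑ π : Equiv.Perm (Fin (p + 1)),
          pairing (weylVector (p + 1) + μ ∘ π) (-weylVector (p + 1)) := by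
  have hc : Continuous fun x : Fin p → ℝ =>
      orbitSum μ (simplexPoint x) * (cueDensity (simplexPoint x) : ℂ) :=
    ((orbitSum_continuous μ).mul
      (Complex.continuous_ofReal.comp cueDensity_continuous)).comp (continuous_simplexPoint p)
  refine tendsto_nhds_unique (tendsto_sum_chains hc) (tendsto_const_nhds.congr' ?_)
  filter_upwards [Filter.eventually_ge_atTop (D + p + 1)] with N hN
  -- This auxiliary level m is at least D, so the degree condition of the discrete formula holds.
  obtain ⟨m, rfl⟩ : ∃ m, N = m + p + 1 := ⟨N - p - 1, by omega⟩
  have h := sum_schurNode_orbitSum (m := m) hμ (by omega)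
  rw [sum_schurNode m p (fun ξ => orbitSum μ ξ * (cueDensity ξ : ℂ)) fun ξ c => by
    rw [orbitSum_add_const hμ.1, cueDensity_eq_mul, altSum_add_const (sum_weylVector _),
      altSum_add_const (by simp [sum_weylVector]), ← cueDensity_eq_mul]] at h
  have hN0 : ((p : ℂ) + 1 + m) ^ p ≠ 0 := by
    refine pow_ne_zero _ ?_
    exact_mod_cast (by omega : p + 1 + m ≠ 0)
  have hcast : ((m + p + 1 : ℕ) : ℂ) = (p : ℂ) + 1 + m := by
    push_cast
    ring
  rw [hcast, eq_div_iff hN0]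
  refine Eq.trans ?_ h.symm
  ring

theorem cueIntegral_orbitSum {p m D : ℕ} {μ : Fin (p + 1) → ℝ} (hμ : WeightLE D μ)
    (hD : D ≤ 2 * m + 1) :
    cueIntegral (p + 1) (orbitSum μ) = (1 / (((p : ℂ) + 1) * ((p : ℂ) + 1 + m) ^ p)) *
      ∑ lam ∈ dominantWeightsFinset m (p + 1),
        orbitSum μ (schurNode m lam) * (cueDensity (schurNode m lam) : ℂ) := by
  have hp : (p : ℂ) + 1 ≠ 0 := by exact_mod_cast Nat.succ_ne_zero p
  have hN0 : ((p : ℂ) + 1 + m) ^ p ≠ 0 := by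
    refine pow_ne_zero _ ?_
    exact_mod_cast (by omega : p + 1 + m ≠ 0)
  rw [cueIntegral_eq (orbitSum_continuous μ) (orbitSum_add_const hμ.1),
    integral_simplex_orbitSum hμ, sum_schurNode_orbitSum hμ hD]
  field_simp

theorem integrableOn_mul_cueDensity {p D : ℕ} {f : (Fin (p + 1) → ℝ) → ℂ}
    (hf : f ∈ symmPoly D (p + 1)) :
    IntegrableOn (fun ξ => f ξ * (cueDensity ξ : ℂ)) (alcove (p + 1))
      (hyperplaneVolume (p + 1)) :=
  integrableOn_alcove ((continuous_of_mem_symmPoly hf).mul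
    (Complex.continuous_ofReal.comp cueDensity_continuous))

theorem cueIntegral_eq_sum {p m : ℕ} {f : (Fin (p + 1) → ℝ) → ℂ}
    (hf : f ∈ symmPoly (2 * m + 1) (p + 1)) :
    cueIntegral (p + 1) f = (1 / (((p : ℂ) + 1) * ((p : ℂ) + 1 + m) ^ p)) *
      ∑ lam ∈ dominantWeightsFinset m (p + 1),
        f (schurNode m lam) * (cueDensity (schurNode m lam) : ℂ) := by
  rw [symmPoly_eq_span] at hf
  induction hf using Submodule.span_induction with
  | mem x h =>
    obtain ⟨κ, hκ, rfl⟩ := h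
    exact cueIntegral_orbitSum hκ le_rfl
  | zero => simp [cueIntegral]
  | add x y hx' hy' hx hy =>
    rw [← symmPoly_eq_span] at hx' hy'
    have h : cueIntegral (p + 1) (x + y) = cueIntegral (p + 1) x + cueIntegral (p + 1) y := by
      simp only [cueIntegral, Pi.add_apply, add_mul]
      rw [integral_add (integrableOn_mul_cueDensity hx') (integrableOn_mul_cueDensity hy'), mul_add]
    rw [h, hx, hy, ← mul_add, ← Finset.sum_add_distrib]
    simp only [Pi.add_apply, add_mul]
  | smul a x _ hx =>
    have h : cueIntegral (p + 1) (a • x) = a * cueIntegral (p + 1) x := by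
      simp only [cueIntegral, Pi.smul_apply, smul_eq_mul, mul_assoc]
      rw [integral_const_mul]
      ring
    rw [h, hx, mul_left_comm, Finset.mul_sum]
    simp only [Pi.smul_apply, smul_eq_mul, mul_assoc]

/-! ### Unisolvence of the nodes -/

theorem antitone_eq_of_comp_perm {n : ℕ} {μ ν : Fin n → ℝ} (hμ : Antitone μ) (hν : Antitone ν)
    {π : Equiv.Perm (Fin n)} (h : μ ∘ π = ν) : μ = ν := by
  have h1 : Monotone ((fun j => -μ j) ∘ (1 : Equiv.Perm (Fin n))) := fun i j hij => by
    simpa using hμ hij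
  have h2 : Monotone ((fun j => -μ j) ∘ π) := fun i j hij => by
    have := hν hij
    rw [← h] at this
    simpa using this
  have h3 := Tuple.unique_monotone h1 h2
  rw [← h]
  funext j
  have := congrFun h3 j
  simpa using this

/-- This is the triangularity of orbit sums against alternating sums. A permutation carrying ϱ + μ∘π
to ϱ + ν preserves the norm, while |ϱ + μ∘π| ≤ |ϱ + μ| by rearrangement. The norm hypothesis then
forces equality, hence μ∘π is antitone. -/
theorem pairing_weylVector_add {n : ℕ} {μ ν : Fin n → ℝ} (hμ : Antitone μ) (hν : Antitone ν)
    (hle : ∑ j, (weylVector n j + μ j) ^ 2 ≤ ∑ j, (weylVector n j + ν j) ^ 2)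
    (π : Equiv.Perm (Fin n)) :
    pairing (weylVector n + μ ∘ π) (-(weylVector n + ν)) =
      if μ = ν ∧ ν ∘ π = ν then 1 else 0 := by
  split_ifs with h
  · obtain ⟨rfl, h⟩ := h
    rw [h]
    exact pairing_neg_self (strictAnti_weylVector_add hμ)
  · refine Finset.sum_eq_zero fun τ _ => ?_
    rw [if_neg, mul_zero]
    intro hτ
    apply h
    have h1 : (weylVector n + μ ∘ π) ∘ τ = weylVector n + ν := by
      rwa [← sub_eq_add_neg, sub_eq_zero] at hτ
    have h2 : ∑ j, (weylVector n j + μ (π j)) ^ 2 = ∑ j, (weylVector n j + ν j) ^ 2 := by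
      rw [← Equiv.sum_comp τ]
      refine Finset.sum_congr rfl fun j _ => ?_
      have := congrFun h1 j
      simp only [Function.comp_apply, Pi.add_apply] at this
      rw [this]
    have hρ : StrictAnti (weylVector n) := by
      simpa using strictAnti_weylVector_add (μ := (0 : Fin n → ℝ)) antitone_const
    have hmono : Monovary (weylVector n) μ := hρ.antitone.monovary hμ
    have h3 := hmono.sum_mul_comp_perm_le_sum_mul (σ := π)
    have h4 : ∑ j, μ (π j) ^ 2 = ∑ j, μ j ^ 2 := Equiv.sum_comp π fun j => μ j ^ 2
    have h5 : ∑ j, weylVector n j * μ (π j) = ∑ j, weylVector n j * μ j := by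
      refine le_antisymm h3 ?_
      simp only [add_sq, Finset.sum_add_distrib, mul_assoc, ← Finset.mul_sum] at h2 hle
      linarith
    -- The equality case of the rearrangement inequality: strict decrease of ϱ forces μ∘π to be
    -- already sorted.
    have h6 : Monovary (weylVector n) (μ ∘ π) := hmono.sum_mul_comp_perm_eq_sum_mul_iff.mp h5
    have h7 : Antitone (μ ∘ π) := by
      intro i j hij
      rcases hij.eq_or_lt with rfl | hij
      · exact le_rfl
      · by_contra hlt
        push Not at hlt
        exact absurd (h6 hlt) (not_le.mpr (hρ hij))
    have h8 : μ ∘ π = ν := by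
      have h9 := antitone_eq_of_comp_perm (strictAnti_weylVector_add h7).antitone
        (strictAnti_weylVector_add hν).antitone h1
      exact add_left_cancel h9
    have h9 := antitone_eq_of_comp_perm hμ hν h8
    exact ⟨h9, by rw [← h9, h8, ← h9]⟩

/-- A vanishing combination is tested against A_ϱ A_{-(ϱ+ν)}, where ν has maximal |ϱ + ν| among the
weights with nonzero coefficient. Triangularity leaves only the term of ν, multiplied by a positive
constant and the order of its stabilizer. -/
theorem sum_orbitSum_unisolvent {p m : ℕ} {c : (Fin (p + 1) → ℝ) → ℂ}
    (h : ∀ lam ∈ dominantWeightsFinset m (p + 1),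
      ∑ μ ∈ dominantWeightsFinset m (p + 1), c μ * orbitSum μ (schurNode m lam) = 0) :
    ∀ μ ∈ dominantWeightsFinset m (p + 1), c μ = 0 := by
  by_contra hne
  push Not at hne
  obtain ⟨μ₀, hμ₀, hc₀⟩ := hne
  obtain ⟨ν, hν, hmax⟩ := Finset.exists_max_image
    ((dominantWeightsFinset m (p + 1)).filter fun μ => c μ ≠ 0)
    (fun μ => ∑ j, (weylVector (p + 1) j + μ j) ^ 2) ⟨μ₀, Finset.mem_filter.mpr ⟨hμ₀, hc₀⟩⟩
  rw [Finset.mem_filter] at hν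
  obtain ⟨hνΛ, hcν⟩ := hν
  obtain ⟨hwν, haν⟩ := mem_dominantWeightsFinset_iff.mp hνΛ
  set ρ := weylVector (p + 1) with hρ
  set K : ℂ := ((p : ℂ) + 1) * ((p : ℂ) + 1 + m) ^ p with hK
  have hK0 : K ≠ 0 := by
    refine mul_ne_zero (by exact_mod_cast Nat.succ_ne_zero p) (pow_ne_zero _ ?_)
    exact_mod_cast (by omega : p + 1 + m ≠ 0)
  have h1 : ∑ lam ∈ dominantWeightsFinset m (p + 1),
      (∑ μ ∈ dominantWeightsFinset m (p + 1), c μ * orbitSum μ (schurNode m lam)) *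
        (altSum ρ (schurNode m lam) * altSum (-(ρ + ν)) (schurNode m lam)) = 0 :=
    Finset.sum_eq_zero fun lam hlam => by rw [h lam hlam, zero_mul]
  have h2 : ∀ μ ∈ dominantWeightsFinset m (p + 1), ∑ lam ∈ dominantWeightsFinset m (p + 1),
      c μ * orbitSum μ (schurNode m lam) *
        (altSum ρ (schurNode m lam) * altSum (-(ρ + ν)) (schurNode m lam)) =
      if μ = ν then c ν * (K * ((Finset.univ.filter fun π : Equiv.Perm (Fin (p + 1)) =>
        ν ∘ π = ν).card : ℂ)) else 0 := by
    intro μ hμ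
    obtain ⟨hwμ, haμ⟩ := mem_dominantWeightsFinset_iff.mp hμ
    by_cases hcμ : c μ = 0
    · rw [if_neg (by rintro rfl; exact hcν hcμ)]
      exact Finset.sum_eq_zero fun lam _ => by rw [hcμ, zero_mul, zero_mul]
    have hpair := fun π => pairing_weylVector_add haμ haν
      (hmax μ (Finset.mem_filter.mpr ⟨hμ, hcμ⟩)) π
    have h3 : ∀ lam, c μ * orbitSum μ (schurNode m lam) *
        (altSum ρ (schurNode m lam) * altSum (-(ρ + ν)) (schurNode m lam)) =
        c μ * ∑ π : Equiv.Perm (Fin (p + 1)),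
          altSum (ρ + μ ∘ π) (schurNode m lam) * altSum (-(ρ + ν)) (schurNode m lam) := by
      intro lam
      rw [← Finset.sum_mul, ← orbitSum_mul_altSum]
      ring
    simp only [h3]
    rw [← Finset.mul_sum, Finset.sum_comm]
    have h4 : ∀ π : Equiv.Perm (Fin (p + 1)), ∑ lam ∈ dominantWeightsFinset m (p + 1),
        altSum (ρ + μ ∘ π) (schurNode m lam) * altSum (-(ρ + ν)) (schurNode m lam) =
        K * if μ = ν ∧ ν ∘ π = ν then 1 else 0 := by
      intro π
      rw [← hpair π]
      exact sum_schurNode_altSum_mul_altSum (weightLE_weylVector_add (hwμ.comp_perm π))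
        (weightLE_weylVector_add hwν).neg (by omega)
    rw [Finset.sum_congr rfl fun π _ => h4 π, ← Finset.mul_sum]
    split_ifs with hμν
    · subst hμν
      simp
    · simp [hμν]
  simp only [Finset.sum_mul] at h1
  rw [Finset.sum_comm, Finset.sum_congr rfl h2, Finset.sum_ite_eq', if_pos hνΛ] at h1
  have hcard : (Finset.univ.filter fun π : Equiv.Perm (Fin (p + 1)) => ν ∘ π = ν).card ≠ 0 :=
    Finset.card_ne_zero_of_mem (a := 1) (by simp)
  exact mul_ne_zero hcν (mul_ne_zero hK0 (by exact_mod_cast hcard)) h1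

theorem symmPoly_eq_span_orbitSum (m p : ℕ) :
    symmPoly m (p + 1) = Submodule.span ℂ
      (Set.range fun μ : dominantWeightsFinset m (p + 1) => orbitSum (μ : Fin (p + 1) → ℝ)) := by
  apply le_antisymm
  · refine Submodule.span_le.mpr ?_
    rintro _ ⟨μ, hμ, rfl⟩
    rw [symmMonomial_eq]
    exact Submodule.smul_mem _ _ (Submodule.subset_span
      ⟨⟨μ, (dominantWeights_finite m (p + 1)).mem_toFinset.mpr hμ⟩, rfl⟩)
  · refine Submodule.span_le.mpr ?_
    rintro _ ⟨μ, rfl⟩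
    exact orbitSum_mem_symmPoly (mem_dominantWeightsFinset_iff.mp μ.2).1

theorem sum_smul_orbitSum_unisolvent {p m : ℕ} {c : dominantWeightsFinset m (p + 1) → ℂ}
    (h : ∀ lam ∈ dominantWeightsFinset m (p + 1),
      (∑ μ, c μ • orbitSum (μ : Fin (p + 1) → ℝ)) (schurNode m lam) = 0) (μ) : c μ = 0 := by
  set c' : (Fin (p + 1) → ℝ) → ℂ := fun μ =>
    if h : μ ∈ dominantWeightsFinset m (p + 1) then c ⟨μ, h⟩ else 0 with hc'
  have hcc : ∀ μ : dominantWeightsFinset m (p + 1), c' μ = c μ := fun μ => dif_pos μ.2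
  rw [← hcc]
  refine sum_orbitSum_unisolvent (c := c') (fun lam hlam => ?_) μ.1 μ.2
  rw [← Finset.sum_coe_sort]
  simp only [hcc]
  simpa using h lam hlam

theorem finrank_symmPoly (m p : ℕ) :
    Module.finrank ℂ (symmPoly m (p + 1)) = (m + p).choose m := by
  have h : LinearIndependent ℂ fun μ : dominantWeightsFinset m (p + 1) =>
      orbitSum (μ : Fin (p + 1) → ℝ) := by
    rw [Fintype.linearIndependent_iff]
    intro c hc
    refine sum_smul_orbitSum_unisolvent fun lam _ => ?_
    rw [hc]
    rfl
  rw [symmPoly_eq_span_orbitSum, finrank_span_eq_card h, Fintype.card_coe,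
    card_dominantWeightsFinset]

theorem eq_zero_of_schurNode {p m : ℕ} {f : (Fin (p + 1) → ℝ) → ℂ}
    (hf : f ∈ symmPoly m (p + 1))
    (h : ∀ lam ∈ dominantWeightsFinset m (p + 1), f (schurNode m lam) = 0) : f = 0 := by
  rw [symmPoly_eq_span_orbitSum] at hf
  obtain ⟨c, rfl⟩ := (Submodule.mem_span_range_iff_exists_fun ℂ).mp hf
  exact Finset.sum_eq_zero fun μ _ => by rw [sum_smul_orbitSum_unisolvent h μ, zero_smul]

/-! ### Optimality -/

theorem mul_conj_mem_symmPoly {p m : ℕ} {f : (Fin (p + 1) → ℝ) → ℂ}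
    (hf : f ∈ symmPoly m (p + 1)) :
    (fun ξ => f ξ * (starRingEnd ℂ) (f ξ)) ∈ symmPoly (2 * m) (p + 1) := by
  rw [two_mul]
  exact mul_mem_symmPoly hf (conj_mem_symmPoly hf)

/-- Definiteness is read off from the Schur rule, whose weights times densities are positive, rather
than from the integral itself. The degree 2m of |f|² is within its range. -/
theorem eq_zero_of_cueIntegral_mul_conj {p m : ℕ} {f : (Fin (p + 1) → ℝ) → ℂ}
    (hf : f ∈ symmPoly m (p + 1))
    (h : cueIntegral (p + 1) (fun ξ => f ξ * (starRingEnd ℂ) (f ξ)) = 0) : f = 0 := by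
  rw [cueIntegral_eq_sum (m := m) (symmPoly_mono (by omega) (mul_conj_mem_symmPoly hf))] at h
  have hK0 : (1 : ℂ) / (((p : ℂ) + 1) * ((p : ℂ) + 1 + m) ^ p) ≠ 0 := by
    refine one_div_ne_zero (mul_ne_zero (by exact_mod_cast Nat.succ_ne_zero p) (pow_ne_zero _ ?_))
    exact_mod_cast (by omega : p + 1 + m ≠ 0)
  have h1 := (mul_eq_zero.mp h).resolve_left hK0
  have h2 : ∑ lam ∈ dominantWeightsFinset m (p + 1),
      ‖f (schurNode m lam)‖ ^ 2 * cueDensity (schurNode m lam) = 0 := by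
    apply Complex.ofReal_injective
    rw [Complex.ofReal_zero, ← h1]
    push_cast
    refine Finset.sum_congr rfl fun lam _ => ?_
    rw [Complex.mul_conj, Complex.normSq_eq_norm_sq]
    push_cast
    rfl
  rw [Finset.sum_eq_zero_iff_of_nonneg fun lam _ =>
    mul_nonneg (sq_nonneg _) (cueDensity_nonneg _)] at h2
  refine eq_zero_of_schurNode hf fun lam hlam => ?_
  have h3 := h2 lam hlam
  have h4 := cueDensity_pos (schurNode_mem_alcove
    ((dominantWeights_finite m (p + 1)).mem_toFinset.mp hlam))
  simpa using (mul_eq_zero.mp h3).resolve_right h4.ne'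

/-- Evaluation of degree-m polynomials at the nodes is injective: a polynomial f in the kernel has
|f|² of integral zero. Only exactness in degree 2m is used, and the weights may be arbitrary complex
numbers. -/
theorem choose_le_of_isExactCubature {p m D N : ℕ} (hD : 2 * m ≤ D)
    {x : Fin N → Fin (p + 1) → ℝ} {w : Fin N → ℂ}
    (h : IsExactCubature (p + 1) D N x w) : (m + p).choose m ≤ N := by
  let ev : symmPoly m (p + 1) →ₗ[ℂ] (Fin N → ℂ) :=
    { toFun := fun f i => (f : (Fin (p + 1) → ℝ) → ℂ) (x i)
      map_add' := fun f g => rfl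
      map_smul' := fun a f => rfl }
  have hinj : Function.Injective ev := by
    rw [← LinearMap.ker_eq_bot, LinearMap.ker_eq_bot']
    rintro ⟨f, hf⟩ hev
    have hx : ∀ i, f (x i) = 0 := fun i => congrFun hev i
    refine Subtype.ext (eq_zero_of_cueIntegral_mul_conj hf ?_)
    rw [h.2 _ (symmPoly_mono hD (mul_conj_mem_symmPoly hf))]
    exact Finset.sum_eq_zero fun i _ => by rw [hx, zero_mul, mul_zero]
  have := LinearMap.finrank_le_finrank_of_injective hinj
  rwa [finrank_symmPoly, Module.finrank_fin_fun] at this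

theorem ncard_schurNode (m p : ℕ) :
    (schurNode m '' dominantWeights m (p + 1)).ncard = (m + p).choose m := by
  have hinj : Function.Injective (schurNode (n := p + 1) m) := by
    intro lam lam' h
    rw [schurNode_eq_smul, schurNode_eq_smul] at h
    have hpi := Real.two_pi_pos
    have hc : 2 * Real.pi / ((m : ℝ) + (p + 1 : ℕ)) ≠ 0 := by positivity
    exact add_left_cancel (smul_right_injective _ hc h)
  rw [Set.ncard_image_of_injective _ hinj,
    Set.ncard_eq_toFinset_card _ (dominantWeights_finite m (p + 1))]
  exact card_dominantWeightsFinset m p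

end SchurCubature

end

theorem mainTheorem8 (m n : ℕ) (hm : 0 < m) (hn : 1 ≤ n) :
    -- at `q = 0` the spectral nodes are the points `2π(ρ + λ)/(m + n)`, and lie in the alcove
    (∀ lam ∈ SchurCubature.dominantWeights m n,
      (∀ ξ : Fin n → ℝ, SchurCubature.IsSpectralNode m 0 lam ξ ↔
        ξ = SchurCubature.schurNode m lam) ∧
      SchurCubature.schurNode m lam ∈ SchurCubature.alcove n) ∧
    -- at `q = 0` the density `|C|⁻²` is the density of the circular unitary ensemble
    (∀ ξ ∈ SchurCubature.alcove n,
      (‖SchurCubature.cFun 0 ξ‖ ^ 2)⁻¹ = SchurCubature.cueDensity ξ) ∧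
    -- at `q = 0` all Christoffel weights are equal
    (∀ lam ∈ SchurCubature.dominantWeights m n,
      SchurCubature.christoffel m 0 (SchurCubature.schurNode m lam) =
        1 / ((n : ℝ) * ((n : ℝ) + m) ^ (n - 1))) ∧
    -- the cubature rule is exact up to degree `2m + 1`
    (∀ f ∈ SchurCubature.symmPoly (2 * m + 1) n,
      IntegrableOn (fun ξ => f ξ * (SchurCubature.cueDensity ξ : ℂ))
        (SchurCubature.alcove n) (SchurCubature.hyperplaneVolume n) ∧
      SchurCubature.cueIntegral n f =
        (1 / ((n : ℂ) * ((n : ℂ) + m) ^ (n - 1))) *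
          ∑ lam ∈ SchurCubature.dominantWeightsFinset m n,
            f (SchurCubature.schurNode m lam) *
              (SchurCubature.cueDensity (SchurCubature.schurNode m lam) : ℂ)) ∧
    -- the rule is Gaussian: it has the least number of nodes possible for exactness of this degree
    (SchurCubature.schurNode m '' SchurCubature.dominantWeights m n).ncard =
        (m + n - 1).choose m ∧
    Module.finrank ℂ (SchurCubature.symmPoly m n) = (m + n - 1).choose m ∧
    (∀ (N : ℕ) (x : Fin N → Fin n → ℝ) (w : Fin N → ℂ),
      SchurCubature.IsExactCubature n (2 * m + 1) N x w → (m + n - 1).choose m ≤ N) ∧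
    -- and no rule with this number of nodes is exact in degree `2m + 2`
    (2 ≤ n → ¬ ∃ (x : Fin ((m + n - 1).choose m) → Fin n → ℝ)
      (w : Fin ((m + n - 1).choose m) → ℂ),
      SchurCubature.IsExactCubature n (2 * m + 2) ((m + n - 1).choose m) x w) := by
  obtain ⟨p, rfl⟩ : ∃ p, n = p + 1 := ⟨n - 1, by omega⟩
  have hp : m + (p + 1) - 1 = m + p := by omega
  rw [hp, Nat.add_sub_cancel]
  push_cast
  refine ⟨fun lam hlam => ⟨fun ξ => ?_, SchurCubature.schurNode_mem_alcove hlam⟩,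
    fun ξ _ => SchurCubature.inv_norm_cFun_zero_sq ξ,
    fun lam hlam => SchurCubature.christoffel_zero hlam,
    fun f hf => ⟨SchurCubature.integrableOn_mul_cueDensity hf,
      SchurCubature.cueIntegral_eq_sum hf⟩,
    SchurCubature.ncard_schurNode m p, SchurCubature.finrank_symmPoly m p,
    fun N x w h => SchurCubature.choose_le_of_isExactCubature (by omega) h, ?_⟩
  · exact SchurCubature.isSpectralNode_zero_iff (Nat.succ_pos p) hm
      (SchurCubature.mem_dominantWeights_iff.mp hlam).1.1 ξ
  · rintro h2 ⟨x, w, h⟩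
    -- Exactness in degree 2m + 2 = 2(m + 1) triggers the node bound for m + 1.
    have h3 := SchurCubature.choose_le_of_isExactCubature (m := m + 1) (by omega) h
    have h4 : m + 1 + p = m + p + 1 := by omega
    rw [h4, Nat.choose_succ_succ'] at h3
    -- By Pascal's rule this is the excess of the new bound over the assumed number of nodes. It is
    -- positive because p ≥ 1, which is where n ≥ 2 enters.
    have h5 : 0 < (m + p).choose (m + 1) := Nat.choose_pos (by omega)
    omega
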